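/- **Conventions.** All parameters are functions of a security parameter $\lambda\in\mathbb N$: $n,m,\ell\ge 0$, a modulus $q\ge 1$ (not necessarily prime, of any size), and a real $W>0$, where $n,m,\ell,\log q$ are polynomially bounded. An *efficient algorithm* is a polynomial-size family, indexed by $\lambda$, of quantum circuits built from one- and two-qubit unitaries, with workspace initialised to $|0\rangle$ (non-uniform quantum polynomial time). *Negligible* means $o(\lambda^{-c})$ for every $c$. Elements of $\mathbb Z_q$ are stored in binary, and $|\mathbf y|_2$ for $\mathbf y\in\mathbb Z_q^m$ is the Euclidean norm of the representative with entries in $(-q/2,q/2]$. **Sampling.** Let $D$ be any distribution over matrices $\mathbf S\in\mathbb Z_q^{m\times\ell}$ such that for every $\mathbf S$ in its support there is a matrix $\mathbf C=\mathbf C(\mathbf S)\in\mathbb Z_q^{m\times(m-\ell)}$ whose columns span $\{\mathbf v\in\mathbb Z_q^m:\mathbf S^T\mathbf v=0\}$; fix such a $\mathbf C(\mathbf S)$. (If $\ell>m$, read $m-\ell$ as $0$.) Sample $\mathbf S\leftarrow D$, and then $\mathbf A\in\mathbb Z_q^{m\times n}$ uniformly subject to $\mathbf A^T\mathbf S=0\bmod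 q$. (In applications $\ell$ is constant and the columns of $\mathbf S$ are short vectors.) **The LWE problem.** For $\Sigma=\Sigma(\lambda)>0$, the $(n,m,q,\Sigma,\ell,D)$-LWE problem is *hard* if every efficient algorithm has negligible advantage in distinguishing $$(\mathbf S,\mathbf A,\ \mathbf A\mathbf r+\mathbf e)\quad\text{from}\quad(\mathbf S,\mathbf A,\ \mathbf C\mathbf r'+\mathbf e),$$ where $\mathbf r\in\mathbb Z_q^n$ and $\mathbf r'\in\mathbb Z_q^{m-\ell}$ are uniform and $\mathbf e\in\mathbb Z^m$ is discrete Gaussian of width $\Sigma$, i.e. has probability proportional to $e^{-\pi|\mathbf e|^2/\Sigma^2}$. **Theorem.** (1) Suppose there is a $\Sigma$ with $q/(W\Sigma)=\omega(\sqrt{\log\lambda})$ such that $(n,m,q,\Sigma,\ell,D)$-LWE is hard. Consider any efficient algorithm that, given $(\mathbf S,\mathbf A)$, outputs $\mathbf u\in\mathbb Z_q^n$ and a state $|\phi_{\mathbf u}\rangle$ of a register holding a vector of $\mathbb Z_q^m$, possibly entangled with side information which the algorithm also outputs, such that for all $(\mathbf S,\mathbf A)$ that can occur the state is supported on vectors $\mathbf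 y$ with $\mathbf A^T\mathbf y=\mathbf u\bmod q$ and $|\mathbf y|_2\le W$. Let $|\phi'_{\mathbf u}\rangle$ be the result of applying to $|\phi_{\mathbf u}\rangle$ the partial measurement of $\mathbf C^T\mathbf y$. Then no efficient algorithm that is given $(\mathbf S,\mathbf A)$, $\mathbf u$, the side information, and either (A) $|\phi_{\mathbf u}\rangle$ or (B) $|\phi'_{\mathbf u}\rangle$, distinguishes (A) from (B) with non-negligible advantage. (2) (The case $\ell=0$.) Let $\mathbf A\in\mathbb Z_q^{m\times n}$ be uniform, and suppose there is a $\Sigma$ with $q/(W\Sigma)=\omega(\sqrt{\log\lambda})$ such that plain LWE is hard, i.e. $(\mathbf A,\mathbf A\mathbf r+\mathbf e)$ and $(\mathbf A,\mathbf v)$ with $\mathbf v\in\mathbb Z_q^m$ uniform are indistinguishable for efficient algorithms. Then the SIS hash function $\mathbf y\mapsto\mathbf A^T\mathbf y\bmod q$ on $\{\mathbf y\in\mathbb Z_q^m:|\mathbf y|_2\le W\}$ is collapsing: for every efficient algorithm which on input $\mathbf A$ outputs a value $\mathbf u$ and a state (possibly with side information, as in (1)) supported on preimages $\mathbf y$ of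 $\mathbf u$ in this set, no efficient algorithm given $\mathbf A$, $\mathbf u$ and all output registers can tell, with non-negligible advantage, whether or not $\mathbf y$ has been measured. -/

import Mathlib

open Matrix Filter

noncomputable section

namespace LatticeCollapse

/-! ### Quantum circuits -/

/-- Unnormalised pure states of a register whose qubits are labelled by `ι`: amplitudes indexed by
the computational basis `ι → Bool`. -/
abbrev State (ι : Type) := (ι → Bool) → ℂ

/-- The computational basis state `|x⟩`. -/
def ket {ι : Type} [Fintype ι] [DecidableEq ι] (x : ι → Bool) : State ι := Pi.single x 1

/-- The tensor product of states of two registers. -/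
def tensor {ι κ : Type} (φ : State ι) (ψ : State κ) : State (ι ⊕ κ) :=
  fun x => φ (x ∘ Sum.inl) * ψ (x ∘ Sum.inr)

/-- A quantum gate: a unitary acting on at most two distinct qubits of the register. -/
structure Gate (ι : Type) where
  arity : ℕ
  arity_le : arity ≤ 2
  wires : Fin arity ↪ ι
  mat : Matrix.unitaryGroup (Fin arity → Bool) ℂ

/-- The action of a gate: the unitary acts on the qubits in the range of `wires`, the identity acts
on the others. `Function.extend g.wires z x` is `x` with the bits on the wires replaced by `z`. -/
def Gate.apply {ι : Type} (g : Gate ι) (ψ : State ι) : State ι :=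
  fun x => ∑ z : Fin g.arity → Bool,
    (g.mat : Matrix (Fin g.arity → Bool) (Fin g.arity → Bool) ℂ) (x ∘ g.wires) z *
      ψ (Function.extend g.wires z x)

/-- A quantum circuit is a finite sequence of gates; its number of steps is its length. -/
abbrev Circuit (ι : Type) := List (Gate ι)

/-- Run a circuit, first gate of the list first. -/
def Circuit.run {ι : Type} (c : Circuit ι) (ψ : State ι) : State ι :=
  c.foldl (fun φ g => g.apply φ) ψ

/-- A quantum decision procedure with input register `ι`: it adjoins `work` workspace qubits in
state `|0⟩`, runs a circuit, and measures one output qubit. -/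
structure Decider (ι : Type) where
  work : ℕ
  circuit : Circuit (ι ⊕ Fin work)
  out : ι ⊕ Fin work

/-- Size of a decision procedure: number of gates plus number of workspace qubits. -/
def Decider.size {ι : Type} (D : Decider ι) : ℕ := D.circuit.length + D.work

/-- (Unnormalised) probability that the output qubit is measured to be `1` on input state `φ`. -/
def Decider.acceptProb {ι : Type} [Fintype ι] [DecidableEq ι] (D : Decider ι) (φ : State ι) : ℝ :=
  ∑ x : ι ⊕ Fin D.work → Bool,
    if x D.out = true then ‖D.circuit.run (tensor φ (ket fun _ => false)) x‖ ^ 2 else 0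

/-- The probability that `D` accepts, when the classical string `s` and the state `ψ`, after the
partial measurement `x ↦ f x` of `ψ` in the computational basis (with outcome discarded), are given
to `D`. -/
def Decider.acceptAfterMeasure {ι κ α : Type} [Fintype ι] [DecidableEq ι] [Fintype κ]
    [DecidableEq κ] [Fintype α] [DecidableEq α] (D : Decider (ι ⊕ κ)) (s : ι → Bool)
    (ψ : State κ) (f : (κ → Bool) → α) : ℝ :=
  ∑ a : α, D.acceptProb (tensor (ket s) fun x => if f x = a then ψ x else 0)

/-- A quantum state generator with classical input register `ι` and designated output register `κ`:
the input is followed by the output register and `work` workspace qubits, all in state `|0⟩`. -/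
structure Generator (ι κ : Type) where
  work : ℕ
  circuit : Circuit (ι ⊕ (κ ⊕ Fin work))

/-- Size of a generator: number of gates plus number of workspace qubits. -/
def Generator.size {ι κ : Type} (G : Generator ι κ) : ℕ := G.circuit.length + G.work

/-- The joint final state of all registers of the generator on the classical input `s`. -/
def Generator.output {ι κ : Type} [Fintype ι] [DecidableEq ι] [Fintype κ] [DecidableEq κ]
    (G : Generator ι κ) (s : ι → Bool) : State (ι ⊕ (κ ⊕ Fin G.work)) :=
  G.circuit.run (tensor (ket s) (ket fun _ => false))

/-! ### Asymptotics -/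

/-- Polynomially bounded functions of the security parameter. -/
def PolyBounded (f : ℕ → ℕ) : Prop := ∃ p : Polynomial ℕ, ∀ l, f l ≤ p.eval l

/-- Negligible functions of the security parameter. -/
def Negligible (f : ℕ → ℝ) : Prop :=
  Asymptotics.SuperpolynomialDecay atTop (fun l : ℕ => (l : ℝ)) f

/-! ### Encodings and lengths modulo `q` -/

/-- Qubit labels for a vector in `ℤ_q^m`, each entry written in binary. -/
abbrev VecLabel (m q : ℕ) := Fin m × Fin (Nat.size q)

/-- Qubit labels for a matrix in `ℤ_q^{m × n}`, each entry written in binary. -/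
abbrev MatLabel (m n q : ℕ) := (Fin m × Fin n) × Fin (Nat.size q)

/-- Binary encoding of a vector, entries represented in `{0, …, q - 1}`. -/
def encVec {m q : ℕ} (v : Fin m → ZMod q) : VecLabel m q → Bool :=
  fun p => (v p.1).val.testBit p.2

/-- The vector encoded by a bit string. -/
def decVec {m q : ℕ} (b : VecLabel m q → Bool) : Fin m → ZMod q :=
  fun i => ∑ j : Fin (Nat.size q), if b (i, j) = true then (2 : ZMod q) ^ (j : ℕ) else 0

/-- Binary encoding of a matrix, entries represented in `{0, …, q - 1}`. -/
def encMat {m n q : ℕ} (A : Matrix (Fin m) (Fin n) (ZMod q)) : MatLabel m n q → Bool :=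
  fun p => (A p.1.1 p.1.2).val.testBit p.2

/-- Euclidean length of a vector modulo `q`, through the representatives in `(-q/2, q/2]`. -/
def euclLength {m q : ℕ} (y : Fin m → ZMod q) : ℝ :=
  √(∑ i, ((y i).valMinAbs : ℝ) ^ 2)

/-! ### Discrete Gaussians -/

/-- The Gaussian weight `exp (-π ‖x‖² / σ²)`. -/
def gaussianWeight (m : ℕ) (σ : ℝ) (x : Fin m → ℤ) : ENNReal :=
  ENNReal.ofReal (Real.exp (-Real.pi * (∑ i, (x i : ℝ) ^ 2) / σ ^ 2))

theorem gaussianWeight_tsum_ne_zero (m : ℕ) (σ : ℝ) : ∑' x, gaussianWeight m σ x ≠ 0 := by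
  intro h
  have := (ENNReal.tsum_eq_zero.1 h) 0
  simp [gaussianWeight] at this

theorem gaussianWeight_tsum_ne_top (m : ℕ) (σ : ℝ) (hσ : 0 < σ) :
    ∑' x, gaussianWeight m σ x ≠ ⊤ := by
  have h1 : ∑' k : ℤ, ENNReal.ofReal (Real.exp (-Real.pi * (k : ℝ) ^ 2 / σ ^ 2)) ≠ ⊤ := by
    have hs := summable_pow_mul_jacobiTheta₂_term_bound 0 (T := 1 / σ ^ 2) (by positivity) 0
    refine (Summable.congr hs fun k => ?_).tsum_ofReal_ne_top
    simp
    ring_nf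
  induction m with
  | zero => simp [gaussianWeight]
  | succ m ih =>
    rw [← (Fin.consEquiv fun _ => ℤ).tsum_eq, ENNReal.tsum_prod']
    have : ∀ (k : ℤ) (x : Fin m → ℤ), gaussianWeight (m + 1) σ ((Fin.consEquiv fun _ => ℤ) (k, x))
        = ENNReal.ofReal (Real.exp (-Real.pi * (k : ℝ) ^ 2 / σ ^ 2)) * gaussianWeight m σ x := by
      intro k x
      simp only [gaussianWeight, Fin.consEquiv, Equiv.coe_fn_mk, Fin.sum_univ_succ, Fin.cons_zero,
        Fin.cons_succ]
      rw [← ENNReal.ofReal_mul (Real.exp_nonneg _), ← Real.exp_add]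
      ring_nf
    simp_rw [this, ENNReal.tsum_mul_left, ENNReal.tsum_mul_right]
    exact ENNReal.mul_ne_top h1 ih

/-- The discrete Gaussian distribution of width `σ` on `ℤ^m`. -/
def discreteGaussian (m : ℕ) (σ : ℝ) (hσ : 0 < σ) : PMF (Fin m → ℤ) :=
  PMF.normalize (gaussianWeight m σ) (gaussianWeight_tsum_ne_zero m σ)
    (gaussianWeight_tsum_ne_top m σ hσ)

/-! ### Sampling the matrices, and learning with errors -/

section Sampling

variable {n m ℓ q : ℕ} [NeZero q]

/-- Sample `S` from `D`, then `A` uniformly subject to `Aᵀ S = 0 mod q`. -/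
def keyDist (n : ℕ) (D : PMF (Matrix (Fin m) (Fin ℓ) (ZMod q))) :
    PMF (Matrix (Fin m) (Fin ℓ) (ZMod q) × Matrix (Fin m) (Fin n) (ZMod q)) :=
  D.bind fun S =>
    (PMF.uniformOfFinset
      (Finset.univ.filter fun A : Matrix (Fin m) (Fin n) (ZMod q) => Aᵀ * S = 0)
      ⟨0, by simp⟩).map fun A => (S, A)

/-- Qubit labels for the pair `(S, A)`. -/
abbrev KeyLabel (n m ℓ q : ℕ) := MatLabel m ℓ q ⊕ MatLabel m n q

/-- Binary encoding of the pair `(S, A)`. -/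
def encKey (k : Matrix (Fin m) (Fin ℓ) (ZMod q) × Matrix (Fin m) (Fin n) (ZMod q)) :
    KeyLabel n m ℓ q → Bool :=
  Sum.elim (encMat k.1) (encMat k.2)

/-- The distribution of `B r + e mod q` with `r` uniform and `e` Gaussian of width `σ`. -/
def noisyImage {k : ℕ} (σ : ℝ) (hσ : 0 < σ) (B : Matrix (Fin m) (Fin k) (ZMod q)) :
    PMF (Fin m → ZMod q) :=
  (PMF.uniformOfFintype (Fin k → ZMod q)).bind fun r =>
    (discreteGaussian m σ hσ).map fun e => B *ᵥ r + fun i => (e i : ZMod q)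

/-- The probability that `E` accepts `(S, A, b)`, where `(S, A)` is sampled from `K` and then `b`
from `P (S, A)`. -/
def sampleAcceptProb (E : Decider (KeyLabel n m ℓ q ⊕ VecLabel m q))
    (K : PMF (Matrix (Fin m) (Fin ℓ) (ZMod q) × Matrix (Fin m) (Fin n) (ZMod q)))
    (P : Matrix (Fin m) (Fin ℓ) (ZMod q) × Matrix (Fin m) (Fin n) (ZMod q) →
      PMF (Fin m → ZMod q)) : ℝ :=
  ∑ k, ∑ b, (K k).toReal * (P k b).toReal * E.acceptProb (ket (Sum.elim (encKey k) (encVec b)))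

end Sampling

section Problems

variable (n m ℓ q : ℕ → ℕ) [∀ l, NeZero (q l)]

/-- Hardness of the `(n, m, q, σ, ℓ, D)`-LWE problem: `(S, A, A r + e)` and `(S, A, C r' + e)` are
indistinguishable for polynomial-size quantum circuits. -/
def LWEHard (σ : ℕ → ℝ) (hσ : ∀ l, 0 < σ l)
    (D : ∀ l, PMF (Matrix (Fin (m l)) (Fin (ℓ l)) (ZMod (q l))))
    (C : ∀ l, Matrix (Fin (m l)) (Fin (ℓ l)) (ZMod (q l)) →
      Matrix (Fin (m l)) (Fin (m l - ℓ l)) (ZMod (q l))) : Prop :=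
  ∀ E : ∀ l, Decider (KeyLabel (n l) (m l) (ℓ l) (q l) ⊕ VecLabel (m l) (q l)),
    PolyBounded (fun l => (E l).size) →
    Negligible fun l =>
      sampleAcceptProb (E l) (keyDist (n l) (D l)) (fun k => noisyImage (σ l) (hσ l) k.2) -
      sampleAcceptProb (E l) (keyDist (n l) (D l)) (fun k => noisyImage (σ l) (hσ l) (C l k.1))

/-- Hardness of plain LWE: for uniform `A`, the pairs `(A, A r + e)` and `(A, v)` with `v` uniform
are indistinguishable for polynomial-size quantum circuits. (The key is a pair of an `m × 0` matrix,
which carries no information, and a uniform `A`.) -/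
def PlainLWEHard (σ : ℕ → ℝ) (hσ : ∀ l, 0 < σ l) : Prop :=
  ∀ E : ∀ l, Decider (KeyLabel (n l) (m l) 0 (q l) ⊕ VecLabel (m l) (q l)),
    PolyBounded (fun l => (E l).size) →
    Negligible fun l =>
      sampleAcceptProb (E l) (keyDist (n l) (PMF.pure 0)) (fun k => noisyImage (σ l) (hσ l) k.2) -
      sampleAcceptProb (E l) (keyDist (n l) (PMF.pure 0))
        (fun _ => PMF.uniformOfFintype (Fin (m l) → ZMod (q l)))

end Problems

/-! ### The distinguishing experiment -/

section Experiment

variable {n m ℓ q : ℕ} [NeZero q]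

/-- A generator which on input `(S, A)` produces a register for `u ∈ ℤ_q^n`, a register for
`y ∈ ℤ_q^m`, and a side-information register. -/
abbrev Minter (n m ℓ q : ℕ) := Generator (KeyLabel n m ℓ q) (VecLabel n q ⊕ VecLabel m q)

/-- All qubits held by a minter at the end of its run. -/
abbrev Minter.Label (G : Minter n m ℓ q) :=
  KeyLabel n m ℓ q ⊕ ((VecLabel n q ⊕ VecLabel m q) ⊕ Fin G.work)

/-- The bits of the `u`-register. -/
def Minter.uBits (G : Minter n m ℓ q) (x : G.Label → Bool) : VecLabel n q → Bool :=
  fun j => x (Sum.inr (Sum.inl (Sum.inl j)))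

/-- The bits of the `y`-register. -/
def Minter.yBits (G : Minter n m ℓ q) (x : G.Label → Bool) : VecLabel m q → Bool :=
  fun j => x (Sum.inr (Sum.inl (Sum.inr j)))

/-- For every `(S, A)` that can occur, the output state of the minter is supported on basis states
whose `y`-register contains a vector `y` of length at most `W` and whose `u`-register contains
`u = Aᵀ y mod q`. -/
def Minter.Admissible (G : Minter n m ℓ q) (W : ℝ)
    (D : PMF (Matrix (Fin m) (Fin ℓ) (ZMod q))) : Prop :=
  ∀ k ∈ (keyDist n D).support, ∀ x : G.Label → Bool, G.output (encKey k) x ≠ 0 →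
    ∃ (u : Fin n → ZMod q) (y : Fin m → ZMod q), G.uBits x = encVec u ∧ G.yBits x = encVec y ∧
      (k.2)ᵀ *ᵥ y = u ∧ euclLength y ≤ W

/-- Case (A): `u` is obtained by measuring the `u`-register, and `(S, A)`, `u`, and what is left of
all registers of the minter are given to `V`. The value is the probability that `V` accepts. -/
def acceptUnmeasured (G : Minter n m ℓ q) (V : Decider (KeyLabel n m ℓ q ⊕ G.Label))
    (D : PMF (Matrix (Fin m) (Fin ℓ) (ZMod q))) : ℝ :=
  ∑ k, (keyDist n D k).toReal *
    V.acceptAfterMeasure (encKey k) (G.output (encKey k)) G.uBits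

/-- Case (B): as in case (A), but after `u` is obtained the partial measurement `y ↦ f S y` is
applied to the `y`-register. -/
def acceptMeasured {α : Type} [Fintype α] [DecidableEq α]
    (G : Minter n m ℓ q) (V : Decider (KeyLabel n m ℓ q ⊕ G.Label))
    (D : PMF (Matrix (Fin m) (Fin ℓ) (ZMod q)))
    (f : Matrix (Fin m) (Fin ℓ) (ZMod q) → (Fin m → ZMod q) → α) : ℝ :=
  ∑ k, (keyDist n D k).toReal *
    V.acceptAfterMeasure (encKey k) (G.output (encKey k))
      (fun x => (G.uBits x, f k.1 (decVec (G.yBits x))))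

end Experiment

section Conclusions

variable (n m ℓ q : ℕ → ℕ) [∀ l, NeZero (q l)]

/-- For every efficient admissible minter, no efficient `V` distinguishes its output from the same
output after the partial measurement of `Cᵀ y`. -/
def MeasurementIndistinguishable (W : ℕ → ℝ)
    (D : ∀ l, PMF (Matrix (Fin (m l)) (Fin (ℓ l)) (ZMod (q l))))
    (C : ∀ l, Matrix (Fin (m l)) (Fin (ℓ l)) (ZMod (q l)) →
      Matrix (Fin (m l)) (Fin (m l - ℓ l)) (ZMod (q l))) : Prop :=
  ∀ G : ∀ l, Minter (n l) (m l) (ℓ l) (q l),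
    PolyBounded (fun l => (G l).size) → (∀ l, (G l).Admissible (W l) (D l)) →
    ∀ V : ∀ l, Decider (KeyLabel (n l) (m l) (ℓ l) (q l) ⊕ (G l).Label),
      PolyBounded (fun l => (V l).size) →
      Negligible fun l =>
        acceptUnmeasured (G l) (V l) (D l) -
        acceptMeasured (G l) (V l) (D l) (fun S y => (C l S)ᵀ *ᵥ y)

/-- The hash function `y ↦ Aᵀ y mod q`, for uniform `A`, on the vectors of length at most `W`, is
collapsing: no efficient adversary that produces a hash value `u` and a superposition of
preimages `y` of `u` can tell whether or not `y` is measured. -/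
def SISCollapsing (W : ℕ → ℝ) : Prop :=
  ∀ G : ∀ l, Minter (n l) (m l) 0 (q l),
    PolyBounded (fun l => (G l).size) → (∀ l, (G l).Admissible (W l) (PMF.pure 0)) →
    ∀ V : ∀ l, Decider (KeyLabel (n l) (m l) 0 (q l) ⊕ (G l).Label),
      PolyBounded (fun l => (V l).size) →
      Negligible fun l =>
        acceptUnmeasured (G l) (V l) (PMF.pure 0) -
        acceptMeasured (G l) (V l) (PMF.pure 0) (fun _ y => y)

end Conclusions

end LatticeCollapse

end

open LatticeCollapse

/-!
Let `χ` be the standard additive character of `ℤ_q`, and let `g z = 𝔼 χ (e ⬝ᵥ z)` be the Fourier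
transform of the Gaussian noise `e` modulo `q`. Acceptance probabilities of the verifier are quadratic
forms in the amplitudes of the minter's state, so every experiment is described by the kernel by which
it multiplies the entry at a pair of basis states `x`, `x'` of the density matrix. Write `z = y' - y`
for the difference of the contents of the `y`-registers. Measuring `u` keeps the entries with equal
`u`, and the additional measurement deletes those of them for which `f S y ≠ f S y'`
(`Minter.offDiagonal`); it must be shown that these deleted entries contribute a negligible amount.

*The reduction.* Given a sample `b`, run the minter on a copy of the key, multiply the amplitude at
`y` by `χ ((b + t) ⬝ᵥ y)` for a fixed shift `t`, and run the verifier. This needs only diagonal gates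
on pairs of bits of `b` and `y` (`simulate`, `acceptProb_simulate`). Measuring `u` is replaced by fixed
signs `(-1) ^ (c ⬝ᵥ u)`, whose average over `c` is that measurement (`sum_acceptProb_simulate`). On
entries with equal `u`, samples `A r + e` give the kernel `χ (t ⬝ᵥ z) g z`; samples `C r' + e` (or
uniform ones) give the same kernel on pairs with `f S y = f S y'` and zero elsewhere, by orthogonality
of characters (`charSum_noisyImage`, `charSum_uniform`). Hence by hardness the deleted entries weighted
by `χ (t ⬝ᵥ z) g z` contribute a negligible amount, uniformly in `t` and `c`, as these are
non-uniform advice. Primality of `q` plays no role.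

*Removing the weight.* The function `g` is close to one on differences of short vectors, but not
negligibly close. However, `g` times a signed combination of characters `χ (t ⬝ᵥ z)` of total weight
at most `2 ^ K` equals `1 - (1 - g) ^ K` (`exists_approx_inverse`), and the remainder `(1 - g) ^ K`
is negligible for `K ≈ log l` in the norm that matters, that of Schur multipliers: `g (y' - y)` is the
Gram matrix of the unit vectors `e ↦ χ (e ⬝ᵥ y)` in `L²` of the noise, which for `|y| ≤ W` have
distance at most `4 π W σ / q` from the constant `1`, by a second moment bound for the discrete Gaussian
(`sum_noiseDist_mul_le`, `SchurBounded.one_sub_gram`). So `(1 - g) ^ K` has norm at most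
`(8 π W σ / q) ^ K`, which is negligible since `W σ / q` tends to zero, while `2 ^ K` is polynomial
(`abs_acceptUnmeasured_sub_acceptMeasured_le`, `negligible_of_le_two_pow`).
-/

noncomputable section

namespace LatticeCollapse

/-! ### Circuits: relabelling, linearity, unitarity -/

section Circuits

variable {ι κ : Type}

/-- The same gate on a larger register, its qubits being relabelled by `e`. -/
def Gate.map (e : ι ↪ κ) (g : Gate ι) : Gate κ := ⟨g.arity, g.arity_le, g.wires.trans e, g.mat⟩

/-- The same circuit on a larger register, its qubits being relabelled by `e`. -/
def Circuit.map (e : ι ↪ κ) (c : Circuit ι) : Circuit κ := List.map (Gate.map e) c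

theorem Circuit.length_map (e : ι ↪ κ) (c : Circuit ι) : (c.map e).length = c.length :=
  List.length_map _

theorem Circuit.run_append (c d : Circuit ι) (ψ : State ι) :
    Circuit.run (c ++ d) ψ = Circuit.run d (Circuit.run c ψ) := List.foldl_append ..

theorem Circuit.run_cons (g : Gate ι) (c : Circuit ι) (ψ : State ι) :
    Circuit.run (g :: c) ψ = Circuit.run c (g.apply ψ) := rfl

theorem extend_inl_comp_inl {k : Type} (w : k ↪ ι) (z : k → Bool) (x : ι ⊕ κ → Bool) :
    Function.extend (w.trans Function.Embedding.inl) z x ∘ Sum.inl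
      = Function.extend w z (x ∘ Sum.inl) := by
  classical
  funext i
  by_cases h : ∃ a, w a = i
  · obtain ⟨a, rfl⟩ := h
    have := (w.trans (Function.Embedding.inl (β := κ))).injective.extend_apply z x a
    simpa [w.injective.extend_apply] using this
  · rw [Function.extend_apply' _ _ _ h, Function.comp_apply, Function.extend_apply']
    · rfl
    · simpa using h

theorem extend_inl_comp_inr {k : Type} (w : k ↪ ι) (z : k → Bool) (x : ι ⊕ κ → Bool) :
    Function.extend (w.trans Function.Embedding.inl) z x ∘ Sum.inr = x ∘ Sum.inr := by
  funext i
  rw [Function.comp_apply, Function.extend_apply']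
  · rfl
  · simp

theorem extend_inr_comp_inr {k : Type} (w : k ↪ κ) (z : k → Bool) (x : ι ⊕ κ → Bool) :
    Function.extend (w.trans Function.Embedding.inr) z x ∘ Sum.inr
      = Function.extend w z (x ∘ Sum.inr) := by
  classical
  funext i
  by_cases h : ∃ a, w a = i
  · obtain ⟨a, rfl⟩ := h
    have := (w.trans (Function.Embedding.inr (α := ι))).injective.extend_apply z x a
    simpa [w.injective.extend_apply] using this
  · rw [Function.extend_apply' _ _ _ h, Function.comp_apply, Function.extend_apply']
    · rfl
    · simpa using h

theorem extend_inr_comp_inl {k : Type} (w : k ↪ κ) (z : k → Bool) (x : ι ⊕ κ → Bool) :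
    Function.extend (w.trans Function.Embedding.inr) z x ∘ Sum.inl = x ∘ Sum.inl := by
  funext i
  rw [Function.comp_apply, Function.extend_apply']
  · rfl
  · simp

theorem Gate.apply_map_inl (g : Gate ι) (φ : State ι) (χ : State κ) :
    (g.map Function.Embedding.inl).apply (tensor φ χ) = tensor (g.apply φ) χ := by
  funext x
  change ∑ z : Fin g.arity → Bool, (g.mat : Matrix (Fin g.arity → Bool) (Fin g.arity → Bool) ℂ)
    (x ∘ (g.wires.trans Function.Embedding.inl)) z *
      (φ (Function.extend (g.wires.trans Function.Embedding.inl) z x ∘ Sum.inl) *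
        χ (Function.extend (g.wires.trans Function.Embedding.inl) z x ∘ Sum.inr)) =
      (∑ z : Fin g.arity → Bool, _) * _
  rw [Finset.sum_mul]
  refine Finset.sum_congr rfl fun z _ => ?_
  rw [extend_inl_comp_inl, extend_inl_comp_inr, ← mul_assoc]
  rfl

theorem Gate.apply_map_inr (g : Gate κ) (φ : State ι) (χ : State κ) :
    (g.map Function.Embedding.inr).apply (tensor φ χ) = tensor φ (g.apply χ) := by
  funext x
  change ∑ z : Fin g.arity → Bool, (g.mat : Matrix (Fin g.arity → Bool) (Fin g.arity → Bool) ℂ)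
    (x ∘ (g.wires.trans Function.Embedding.inr)) z *
      (φ (Function.extend (g.wires.trans Function.Embedding.inr) z x ∘ Sum.inl) *
        χ (Function.extend (g.wires.trans Function.Embedding.inr) z x ∘ Sum.inr)) =
      _ * (∑ z : Fin g.arity → Bool, _)
  rw [Finset.mul_sum]
  refine Finset.sum_congr rfl fun z _ => ?_
  rw [extend_inr_comp_inl, extend_inr_comp_inr, mul_left_comm]
  rfl

theorem Circuit.run_map_inl (c : Circuit ι) (φ : State ι) (χ : State κ) :
    (c.map Function.Embedding.inl).run (tensor φ χ) = tensor (c.run φ) χ := by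
  induction c generalizing φ with
  | nil => rfl
  | cons g c ih => exact (congrArg _ (g.apply_map_inl φ χ)).trans (ih _)

theorem Circuit.run_map_inr (c : Circuit κ) (φ : State ι) (χ : State κ) :
    (c.map Function.Embedding.inr).run (tensor φ χ) = tensor φ (c.run χ) := by
  induction c generalizing χ with
  | nil => rfl
  | cons g c ih => exact (congrArg _ (g.apply_map_inr φ χ)).trans (ih _)

theorem Circuit.run_map_equiv (e : ι ≃ κ) (c : Circuit ι) (ψ : State κ) :
    (c.map e.toEmbedding).run ψ = fun x => c.run (fun r => ψ (r ∘ e.symm)) (x ∘ e) := by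
  induction c generalizing ψ with
  | nil => funext x; simp [Circuit.run, Circuit.map, Function.comp_assoc]
  | cons g c ih =>
    refine (ih _).trans ?_
    funext x
    rw [Circuit.run_cons]
    congr 1
    funext r
    change ∑ z : Fin g.arity → Bool, (g.mat : Matrix (Fin g.arity → Bool) (Fin g.arity → Bool) ℂ)
      ((r ∘ e.symm) ∘ (g.wires.trans e.toEmbedding)) z *
        ψ (Function.extend (g.wires.trans e.toEmbedding) z (r ∘ e.symm)) =
      ∑ z : Fin g.arity → Bool, (g.mat : Matrix (Fin g.arity → Bool) (Fin g.arity → Bool) ℂ)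
        (r ∘ g.wires) z * ψ (Function.extend g.wires z r ∘ e.symm)
    refine Finset.sum_congr rfl fun z _ => ?_
    have h1 : (r ∘ e.symm) ∘ (g.wires.trans e.toEmbedding) = r ∘ g.wires := by
      funext i
      simp
    have h2 : Function.extend (g.wires.trans e.toEmbedding) z (r ∘ e.symm)
        = Function.extend g.wires z r ∘ e.symm := by
      funext k
      obtain ⟨i, rfl⟩ := e.surjective k
      by_cases h : ∃ a, g.wires a = i
      · obtain ⟨a, rfl⟩ := h
        refine ((g.wires.trans e.toEmbedding).injective.extend_apply z (r ∘ e.symm) a).trans ?_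
        simp [g.wires.injective.extend_apply]
      · have h' : ¬ ∃ a, (g.wires.trans e.toEmbedding) a = e i := by
          simpa using h
        rw [Function.extend_apply' _ _ _ h']
        simp [Function.extend_apply' _ _ _ h]
    rw [h1, h2]

/-- A circuit acts linearly. -/
def Circuit.runLinear (c : Circuit ι) : State ι →ₗ[ℂ] State ι where
  toFun := c.run
  map_add' φ ψ := by
    induction c generalizing φ ψ with
    | nil => rfl
    | cons g c ih =>
      simp only [Circuit.run_cons]
      rw [← ih]
      congr 1
      funext x
      simp [Gate.apply, mul_add, Finset.sum_add_distrib]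
  map_smul' a ψ := by
    induction c generalizing ψ with
    | nil => rfl
    | cons g c ih =>
      simp only [Circuit.run_cons]
      rw [RingHom.id_apply] at ih ⊢
      rw [← ih]
      congr 1
      funext x
      simp [Gate.apply, Finset.mul_sum, mul_left_comm]

/-- Summing over all overwritings of `k` bits counts every bit string `2 ^ k` times: exchanging the
old and the new values of these bits is an involution. -/
theorem sum_sum_extend [Fintype ι] [DecidableEq ι] {k : ℕ} (w : Fin k ↪ ι) (F : (ι → Bool) → ℝ) :
    ∑ x : ι → Bool, ∑ z : Fin k → Bool, F (Function.extend w z x)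
      = Fintype.card (Fin k → Bool) * ∑ x, F x := by
  have hinv : Function.Involutive
      fun p : (ι → Bool) × (Fin k → Bool) => (Function.extend w p.2 p.1, p.1 ∘ w) := by
    rintro ⟨x, z⟩
    simp only [Prod.mk.injEq]
    refine ⟨?_, ?_⟩
    · funext i
      by_cases h : ∃ a, w a = i
      · obtain ⟨a, rfl⟩ := h
        simp [w.injective.extend_apply]
      · simp [Function.extend_apply' _ _ _ h]
    · funext a
      simp [w.injective.extend_apply]
  have h := Equiv.sum_comp (hinv.toPerm _) fun p : (ι → Bool) × (Fin k → Bool) => F p.1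
  rw [Fintype.sum_prod_type, Fintype.sum_prod_type] at h
  simpa [Finset.mul_sum] using h

theorem unitary_sum_norm_sq {k : Type} [Fintype k] [DecidableEq k]
    (U : Matrix.unitaryGroup k ℂ) (v : k → ℂ) :
    ∑ i, ‖((U : Matrix k k ℂ) *ᵥ v) i‖ ^ 2 = ∑ i, ‖v i‖ ^ 2 := by
  have key : ∀ w : k → ℂ, ((∑ i, ‖w i‖ ^ 2 : ℝ) : ℂ) = star w ⬝ᵥ w := by
    intro w
    simp [dotProduct, ← Complex.normSq_eq_conj_mul_self, Complex.normSq_eq_norm_sq]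
  have hU : star (U : Matrix k k ℂ) * (U : Matrix k k ℂ) = 1 := Matrix.UnitaryGroup.star_mul_self U
  apply Complex.ofReal_injective
  rw [key (U.1 *ᵥ v), key v, star_mulVec, dotProduct_mulVec, vecMul_vecMul, ← star_eq_conjTranspose, hU,
    vecMul_one]

theorem Gate.sum_norm_sq_apply [Fintype ι] [DecidableEq ι] (g : Gate ι) (ψ : State ι) :
    ∑ x, ‖g.apply ψ x‖ ^ 2 = ∑ x, ‖ψ x‖ ^ 2 := by
  have h1 := sum_sum_extend g.wires fun x => ‖g.apply ψ x‖ ^ 2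
  have h2 := sum_sum_extend g.wires fun x => ‖ψ x‖ ^ 2
  have h3 : ∀ x : ι → Bool, ∑ z : Fin g.arity → Bool, ‖g.apply ψ (Function.extend g.wires z x)‖ ^ 2
      = ∑ z : Fin g.arity → Bool, ‖ψ (Function.extend g.wires z x)‖ ^ 2 := by
    intro x
    rw [← unitary_sum_norm_sq g.mat fun z => ψ (Function.extend g.wires z x)]
    have hw : ∀ z, Function.extend g.wires z x ∘ g.wires = z := fun z => by
      funext a
      simp [g.wires.injective.extend_apply]
    have he : ∀ z z', Function.extend g.wires z' (Function.extend g.wires z x)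
        = Function.extend g.wires z' x := fun z z' => by
      funext i
      by_cases h : ∃ a, g.wires a = i
      · obtain ⟨a, rfl⟩ := h
        simp [g.wires.injective.extend_apply]
      · simp [Function.extend_apply' _ _ _ h]
    refine Finset.sum_congr rfl fun z _ => ?_
    simp only [Gate.apply, mulVec, dotProduct, hw, he]
  rw [Finset.sum_congr rfl fun x _ => h3 x, h2] at h1
  exact (mul_left_cancel₀ (Nat.cast_ne_zero.2 Fintype.card_ne_zero) h1).symm

theorem Circuit.sum_norm_sq_run [Fintype ι] [DecidableEq ι] (c : Circuit ι) (ψ : State ι) :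
    ∑ x, ‖c.run ψ x‖ ^ 2 = ∑ x, ‖ψ x‖ ^ 2 := by
  induction c generalizing ψ with
  | nil => rfl
  | cons g c ih => exact (ih _).trans (g.sum_norm_sq_apply ψ)

theorem ket_apply [Fintype ι] [DecidableEq ι] (x y : ι → Bool) :
    ket x y = if y = x then 1 else 0 := by
  simp [ket, Pi.single_apply]

theorem ket_sum_elim [Fintype ι] [DecidableEq ι] [Fintype κ] [DecidableEq κ]
    (s : ι → Bool) (t : κ → Bool) : ket (Sum.elim s t) = tensor (ket s) (ket t) := by
  funext x
  have : x = Sum.elim s t ↔ x ∘ Sum.inl = s ∧ x ∘ Sum.inr = t := by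
    constructor
    · rintro rfl
      simp
    · rintro ⟨rfl, rfl⟩
      simp
  simp only [tensor, ket_apply, this, ite_and]
  split_ifs <;> simp

theorem sum_bool_sum {M : Type} [AddCommMonoid M] [Fintype ι] [DecidableEq ι] [Fintype κ]
    [DecidableEq κ] (F : (ι ⊕ κ → Bool) → M) :
    ∑ x, F x = ∑ a : ι → Bool, ∑ b : κ → Bool, F (Sum.elim a b) := by
  rw [← (Equiv.sumArrowEquivProdArrow ι κ Bool).symm.sum_comp, Fintype.sum_prod_type]
  rfl

theorem sum_norm_sq_tensor [Fintype ι] [DecidableEq ι] [Fintype κ] [DecidableEq κ]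
    (φ : State ι) (ψ : State κ) :
    ∑ x, ‖tensor φ ψ x‖ ^ 2 = (∑ x, ‖φ x‖ ^ 2) * ∑ x, ‖ψ x‖ ^ 2 := by
  rw [sum_bool_sum, Finset.sum_mul_sum]
  simp [tensor, mul_pow]

theorem sum_norm_sq_ket [Fintype ι] [DecidableEq ι] (s : ι → Bool) :
    ∑ x, ‖ket s x‖ ^ 2 = 1 := by
  rw [Finset.sum_eq_single s] <;> simp +contextual [ket_apply]

theorem Generator.sum_norm_sq_output [Fintype ι] [DecidableEq ι] [Fintype κ] [DecidableEq κ]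
    (G : Generator ι κ) (s : ι → Bool) : ∑ x, ‖G.output s x‖ ^ 2 = 1 := by
  rw [Generator.output, Circuit.sum_norm_sq_run, sum_norm_sq_tensor, sum_norm_sq_ket,
    sum_norm_sq_ket, one_mul]

end Circuits

/-! ### Diagonal gates and copying of classical bits -/

section SpecialGates

variable {ι : Type}

/-- The gate multiplying each basis state by a phase that depends on at most two of its bits. -/
def diagGate {k : ℕ} (hk : k ≤ 2) (w : Fin k ↪ ι) (d : (Fin k → Bool) → Circle) : Gate ι where
  arity := k
  arity_le := hk
  wires := w
  mat := ⟨Matrix.diagonal fun z => (d z : ℂ), by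
    rw [Matrix.mem_unitaryGroup_iff, Matrix.star_eq_conjTranspose, Matrix.diagonal_conjTranspose,
      Matrix.diagonal_mul_diagonal, ← Matrix.diagonal_one]
    congr 1
    funext z
    simp [Complex.mul_conj, Complex.normSq_eq_norm_sq, Circle.norm_coe]⟩

theorem extend_comp_self {α β γ : Type} (w : α ↪ β) (x : β → γ) :
    Function.extend w (x ∘ w) x = x := by
  funext i
  by_cases h : ∃ a, w a = i
  · obtain ⟨a, rfl⟩ := h
    simp [w.injective.extend_apply]
  · simp [Function.extend_apply' _ _ _ h]

theorem diagGate_apply {k : ℕ} (hk : k ≤ 2) (w : Fin k ↪ ι) (d : (Fin k → Bool) → Circle)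
    (ψ : State ι) : (diagGate hk w d).apply ψ = fun x => (d (x ∘ w) : ℂ) * ψ x := by
  funext x
  change ∑ z : Fin k → Bool, Matrix.diagonal (fun z => (d z : ℂ)) (x ∘ w) z *
    ψ (Function.extend w z x) = _
  rw [Finset.sum_eq_single (x ∘ w)]
  · rw [extend_comp_self, Matrix.diagonal_apply_eq]
  · intro z _ hz
    rw [Matrix.diagonal_apply_ne _ hz.symm, zero_mul]
  · intro h
    exact absurd (Finset.mem_univ _) h

/-- The gate multiplying by `d` the basis states in which the bit at `i` is set. -/
def phaseGate (i : ι) (d : Circle) : Gate ι :=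
  diagGate one_le_two ⟨fun _ : Fin 1 => i, fun _ _ _ => Subsingleton.elim _ _⟩
    fun z => if z 0 then d else 1

theorem phaseGate_apply (i : ι) (d : Circle) (ψ : State ι) :
    (phaseGate i d).apply ψ = fun x => (if x i then (d : ℂ) else 1) * ψ x := by
  rw [phaseGate, diagGate_apply]
  funext x
  change ((if x i then d else 1 : Circle) : ℂ) * _ = _
  split_ifs <;> simp

/-- Two distinct qubits as an embedding of `Fin 2`. -/
def wirePair (i j : ι) (h : i ≠ j) : Fin 2 ↪ ι :=
  ⟨![i, j], by
    intro a b hab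
    fin_cases a <;> fin_cases b <;> simp_all [eq_comm]⟩

/-- The gate multiplying by `d` the basis states in which the bits at `i` and `j` are set. -/
def controlledPhaseGate (i j : ι) (h : i ≠ j) (d : Circle) : Gate ι :=
  diagGate le_rfl (wirePair i j h) fun z => if z 0 && z 1 then d else 1

theorem controlledPhaseGate_apply (i j : ι) (h : i ≠ j) (d : Circle) (ψ : State ι) :
    (controlledPhaseGate i j h d).apply ψ
      = fun x => (if x i && x j then (d : ℂ) else 1) * ψ x := by
  rw [controlledPhaseGate, diagGate_apply]
  funext x
  change ((if x i && x j then d else 1 : Circle) : ℂ) * _ = _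
  split_ifs <;> simp

theorem run_map_toList_of_diag {a : Type} [Fintype a] (g : a → Gate ι) (p : a → (ι → Bool) → ℂ)
    (h : ∀ i ψ, (g i).apply ψ = fun x => p i x * ψ x) (ψ : State ι) :
    Circuit.run ((Finset.univ : Finset a).toList.map g) ψ = fun x => (∏ i, p i x) * ψ x := by
  have : ∀ (L : List a) (ψ : State ι),
      Circuit.run (L.map g) ψ = fun x => (L.map fun i => p i x).prod * ψ x := by
    intro L
    induction L with
    | nil => intro ψ; funext x; simp [Circuit.run]
    | cons i L ih =>
      intro ψ
      rw [List.map_cons, Circuit.run_cons, ih, h]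
      funext x
      simp only [List.map_cons, List.prod_cons]
      ring
  rw [this]
  funext x
  rw [Finset.prod_map_toList]

/-- The controlled-not operation on two bits: the first is added to the second. -/
def cnotPerm : Equiv.Perm (Fin 2 → Bool) :=
  Function.Involutive.toPerm (fun z => ![z 0, xor (z 0) (z 1)]) (by
    intro z
    funext i
    fin_cases i <;> simp)

/-- The controlled-not gate with control `i` and target `j`. -/
def cnotGate (i j : ι) (h : i ≠ j) : Gate ι where
  arity := 2
  arity_le := le_rfl
  wires := wirePair i j h
  mat := ⟨cnotPerm.permMatrix ℂ, by
    rw [Matrix.mem_unitaryGroup_iff, Matrix.star_eq_conjTranspose, Matrix.conjTranspose_permMatrix,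
      ← Matrix.permMatrix_mul]
    simp⟩

theorem cnotGate_apply_ket [Fintype ι] [DecidableEq ι] (i j : ι) (h : i ≠ j) (x : ι → Bool) :
    (cnotGate i j h).apply (ket x) = ket (Function.update x j (xor (x i) (x j))) := by
  have ext : ∀ (z : Fin 2 → Bool) (y : ι → Bool), Function.extend (wirePair i j h) z y
      = Function.update (Function.update y i (z 0)) j (z 1) := by
    intro z y
    funext k
    by_cases hj : k = j
    · subst hj
      exact ((wirePair i k h).injective.extend_apply z y 1).trans (by simp)
    by_cases hi : k = i
    · subst hi
      exact ((wirePair k j h).injective.extend_apply z y 0).trans (by simp [hj])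
    · rw [Function.extend_apply']
      · simp [hi, hj]
      · rintro ⟨a, rfl⟩
        fin_cases a
        · exact hi rfl
        · exact hj rfl
  funext y
  change ∑ z : Fin 2 → Bool, cnotPerm.permMatrix ℂ (y ∘ wirePair i j h) z *
    ket x (Function.extend (wirePair i j h) z y) = _
  have hc : cnotPerm (y ∘ wirePair i j h) = ![y i, xor (y i) (y j)] := rfl
  rw [Finset.sum_eq_single (cnotPerm (y ∘ wirePair i j h))]
  · rw [Equiv.Perm.permMatrix, PEquiv.toMatrix_apply, ket_apply, ket_apply, ext, hc]
    simp only [Equiv.toPEquiv_apply, hc, Option.mem_def, if_true, one_mul]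
    congr 1
    simp only [Matrix.cons_val_zero, Matrix.cons_val_one, eq_iff_iff]
    constructor
    · rintro rfl
      funext k
      by_cases hj : k = j
      · subst hj; simp [h]
      by_cases hi : k = i
      · subst hi; simp [h]
      · simp [hj]
    · rintro rfl
      funext k
      by_cases hj : k = j
      · subst hj; simp [h]
      by_cases hi : k = i <;> simp [hi, hj, h]
  · intro z _ hz
    rw [Equiv.Perm.permMatrix, PEquiv.toMatrix_apply, if_neg, zero_mul]
    simpa [Equiv.toPEquiv_apply] using hz.symm
  · intro h
    exact absurd (Finset.mem_univ _) h

/-- Copying the classical bits at `src` into the positions `tgt`, which are all `0`. -/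
theorem run_cnot_toList_ket [Fintype ι] [DecidableEq ι] {a : Type} [Fintype a]
    (src tgt : a → ι) (h : ∀ i j, src i ≠ tgt j) (ht : Function.Injective tgt)
    (x y : ι → Bool) (h0 : ∀ i, x (tgt i) = false) (hy : ∀ i, y (tgt i) = x (src i))
    (hxy : ∀ p, (∀ i, tgt i ≠ p) → y p = x p) :
    Circuit.run ((Finset.univ : Finset a).toList.map fun i => cnotGate (src i) (tgt i) (h i i))
      (ket x) = ket y := by
  have key : ∀ (L : List a), L.Nodup → ∀ x y : ι → Bool, (∀ i ∈ L, x (tgt i) = false) →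
      (∀ i ∈ L, y (tgt i) = x (src i)) → (∀ p, (∀ i ∈ L, tgt i ≠ p) → y p = x p) →
      Circuit.run (L.map fun i => cnotGate (src i) (tgt i) (h i i)) (ket x) = ket y := by
    intro L
    induction L with
    | nil =>
      intro _ x y _ _ hxy
      rw [funext fun p => hxy p (by simp)]
      rfl
    | cons i L ih =>
      intro hL x y h0 hy hxy
      obtain ⟨hi, hL⟩ := List.nodup_cons.1 hL
      rw [List.map_cons, Circuit.run_cons, cnotGate_apply_ket]
      have hne : ∀ k ∈ L, tgt k ≠ tgt i := fun k hk he => hi (ht he ▸ hk)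
      refine ih hL _ _ (fun k hk => ?_) (fun k hk => ?_) fun p hp => ?_
      · rw [Function.update_of_ne (hne k hk), h0 k (List.mem_cons_of_mem _ hk)]
      · rw [Function.update_of_ne (h k i), hy k (List.mem_cons_of_mem _ hk)]
      · by_cases hpi : p = tgt i
        · subst hpi
          simp [hy i, h0 i]
        · rw [Function.update_of_ne hpi]
          refine hxy p fun k hk => ?_
          rcases List.mem_cons.1 hk with rfl | hk
          · exact fun e => hpi e.symm
          · exact hp k hk
  exact key _ (Finset.nodup_toList _) x y (fun i _ => h0 i) (fun i _ => hy i)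
    fun p hp => hxy p fun i => hp i (by simp)

end SpecialGates

/-! ### Schur multipliers -/

section Schur

variable {X : Type} [Fintype X]

/-- The sesquilinear form with matrix `M`. -/
def pairing (M : X → X → ℂ) (v w : X → ℂ) : ℂ := ∑ x, ∑ x', star (v x) * w x' * M x x'

/-- The sesquilinear form with matrix `M` has norm at most `r` for the Euclidean norm. -/
def FormBounded (M : X → X → ℂ) (r : ℝ) : Prop :=
  ∀ v w, ‖pairing M v w‖ ≤ r * (√(∑ x, ‖v x‖ ^ 2) * √(∑ x, ‖w x‖ ^ 2))

/-- Entrywise multiplication by `k` increases the operator norm of a matrix at most by the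
factor `c`. -/
def SchurBounded (k : X → X → ℂ) (c : ℝ) : Prop :=
  ∀ M r, 0 ≤ r → FormBounded M r → FormBounded (fun x x' => M x x' * k x x') (c * r)

theorem pairing_add (M N : X → X → ℂ) (v w : X → ℂ) :
    pairing (fun x x' => M x x' + N x x') v w = pairing M v w + pairing N v w := by
  simp only [pairing, mul_add, Finset.sum_add_distrib]

theorem SchurBounded.one : SchurBounded (fun _ _ : X => (1 : ℂ)) 1 := by
  intro M r _ hM
  simpa using hM

theorem SchurBounded.mul {k k' : X → X → ℂ} {c c' : ℝ} (h : SchurBounded k c) (hc : 0 ≤ c)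
    (h' : SchurBounded k' c') : SchurBounded (fun x x' => k x x' * k' x x') (c' * c) := by
  intro M r hr hM
  have := h' _ _ (mul_nonneg hc hr) (h M r hr hM)
  simpa only [mul_assoc] using this

theorem SchurBounded.add {k k' : X → X → ℂ} {c c' : ℝ} (h : SchurBounded k c)
    (h' : SchurBounded k' c') : SchurBounded (fun x x' => k x x' + k' x x') (c + c') := by
  intro M r hr hM v w
  simp only [mul_add]
  rw [pairing_add, add_mul, add_mul]
  exact (norm_add_le _ _).trans (add_le_add (h M r hr hM v w) (h' M r hr hM v w))

theorem SchurBounded.neg {k : X → X → ℂ} {c : ℝ} (h : SchurBounded k c) :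
    SchurBounded (fun x x' => -k x x') c := by
  intro M r hr hM v w
  have := h M r hr hM v w
  simpa [pairing, Finset.sum_neg_distrib] using this

theorem SchurBounded.pow {k : X → X → ℂ} {c : ℝ} (h : SchurBounded k c) (hc : 0 ≤ c) (n : ℕ) :
    SchurBounded (fun x x' => k x x' ^ n) (c ^ n) := by
  induction n with
  | zero => simpa using SchurBounded.one
  | succ n ih => simpa only [pow_succ', mul_comm] using ih.mul (pow_nonneg hc n) h

/-- A matrix of inner products of vectors of norms at most `a` and `b` is a Schur multiplier of norm
at most `a b`. -/
theorem SchurBounded.gram {I : Type} [Fintype I] (F H : X → I → ℂ) {a b : ℝ} (ha : 0 ≤ a)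
    (hb : 0 ≤ b) (hF : ∀ x, ∑ i, ‖F x i‖ ^ 2 ≤ a ^ 2) (hH : ∀ x, ∑ i, ‖H x i‖ ^ 2 ≤ b ^ 2) :
    SchurBounded (fun x x' => ∑ i, star (F x i) * H x' i) (a * b) := by
  intro M r hr hM v w
  have hsplit : pairing (fun x x' => M x x' * ∑ i, star (F x i) * H x' i) v w
      = ∑ i, pairing M (fun x => v x * F x i) (fun x => w x * H x i) := by
    simp only [pairing, Finset.mul_sum]
    rw [Finset.sum_congr rfl fun x _ => Finset.sum_comm, Finset.sum_comm]
    refine Finset.sum_congr rfl fun i _ => Finset.sum_congr rfl fun x _ =>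
      Finset.sum_congr rfl fun x' _ => ?_
    rw [star_mul']
    ring
  have hnorm : ∀ (u : X → ℂ) (K : X → I → ℂ) (c : ℝ), 0 ≤ c → (∀ x, ∑ i, ‖K x i‖ ^ 2 ≤ c ^ 2) →
      √(∑ i, ∑ x, ‖u x * K x i‖ ^ 2) ≤ c * √(∑ x, ‖u x‖ ^ 2) := by
    intro u K c hc hK
    refine Real.sqrt_le_iff.2 ⟨by positivity, ?_⟩
    rw [mul_pow, Real.sq_sqrt (by positivity), Finset.sum_comm, Finset.mul_sum]
    refine Finset.sum_le_sum fun x _ => ?_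
    simp only [norm_mul, mul_pow, ← Finset.mul_sum]
    rw [mul_comm]
    exact mul_le_mul_of_nonneg_right (hK x) (by positivity)
  rw [hsplit]
  calc ‖∑ i, pairing M (fun x => v x * F x i) (fun x => w x * H x i)‖
      ≤ ∑ i, r * (√(∑ x, ‖v x * F x i‖ ^ 2) * √(∑ x, ‖w x * H x i‖ ^ 2)) :=
        (norm_sum_le _ _).trans (Finset.sum_le_sum fun i _ => hM _ _)
    _ ≤ r * (√(∑ i, ∑ x, ‖v x * F x i‖ ^ 2) * √(∑ i, ∑ x, ‖w x * H x i‖ ^ 2)) := by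
        rw [← Finset.mul_sum]
        exact mul_le_mul_of_nonneg_left (Real.sum_sqrt_mul_sqrt_le _ (fun i => by positivity)
          fun i => by positivity) hr
    _ ≤ r * ((a * √(∑ x, ‖v x‖ ^ 2)) * (b * √(∑ x, ‖w x‖ ^ 2))) := by
        gcongr
        · exact hnorm v F a ha hF
        · exact hnorm w H b hb hH
    _ = a * b * r * (√(∑ x, ‖v x‖ ^ 2) * √(∑ x, ‖w x‖ ^ 2)) := by ring

/-- The pinching onto the level sets of a function does not increase the operator norm. -/
theorem SchurBounded.ite_eq {α : Type} [Fintype α] [DecidableEq α] (f : X → α) :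
    SchurBounded (fun x x' => if f x = f x' then (1 : ℂ) else 0) 1 := by
  have := SchurBounded.gram (fun x i => if f x = i then (1 : ℂ) else 0)
    (fun x i => if f x = i then (1 : ℂ) else 0) zero_le_one zero_le_one
    (fun x => by simp [apply_ite]) (fun x => by simp [apply_ite])
  simpa [apply_ite, eq_comm] using this

theorem SchurBounded.one_sub {k : X → X → ℂ} {c : ℝ} (h : SchurBounded k c) :
    SchurBounded (fun x x' => 1 - k x x') (1 + c) := by
  simpa only [sub_eq_add_neg] using SchurBounded.one.add h.neg

/-- If the functions `F x` have modulus one and distance at most `ε` from the constant function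
`1` in `L²(p)`, then one minus their matrix of inner products is a Schur multiplier of norm at
most `2 ε`. -/
theorem SchurBounded.one_sub_gram {I : Type} [Fintype I] (p : I → ℝ) (hp : ∀ i, 0 ≤ p i)
    (hp1 : ∑ i, p i = 1) (F : X → I → ℂ) {ε : ℝ} (hε : 0 ≤ ε) (hF : ∀ x i, ‖F x i‖ = 1)
    (h : ∀ x, ∑ i, p i * ‖1 - F x i‖ ^ 2 ≤ ε ^ 2) :
    SchurBounded (fun x x' => 1 - ∑ i, (p i : ℂ) * (star (F x i) * F x' i)) (2 * ε) := by
  have hs : ∀ i, ((√(p i) : ℝ) : ℂ) * ((√(p i) : ℝ) : ℂ) = (p i : ℂ) := fun i => by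
    rw [← Complex.ofReal_mul, Real.mul_self_sqrt (hp i)]
  have hn : ∀ i (z : ℂ), ‖((√(p i) : ℝ) : ℂ) * z‖ ^ 2 = p i * ‖z‖ ^ 2 := fun i z => by
    rw [norm_mul, mul_pow, Complex.norm_real, Real.norm_eq_abs, sq_abs, Real.sq_sqrt (hp i)]
  have h1 := SchurBounded.gram (X := X) (fun x i => ((√(p i) : ℝ) : ℂ) * (1 - F x i))
    (fun _ i => ((√(p i) : ℝ) : ℂ) * 1) hε zero_le_one
    (fun x => by simpa only [hn] using h x) (fun x => by simp only [hn]; simp [hp1])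
  have h2 := SchurBounded.gram (X := X) (fun x i => ((√(p i) : ℝ) : ℂ) * F x i)
    (fun x i => ((√(p i) : ℝ) : ℂ) * (1 - F x i)) zero_le_one hε
    (fun x => by simp only [hn]; simp [hp1, hF]) (fun x => by simpa only [hn] using h x)
  have h3 := h1.add h2
  have hc : ε * 1 + 1 * ε = 2 * ε := by ring
  rw [hc] at h3
  convert h3 using 3 with x x'
  rw [← Finset.sum_add_distrib]
  have hp1' : (1 : ℂ) = ∑ i, (p i : ℂ) := by exact_mod_cast hp1.symm
  nth_rewrite 1 [hp1']
  rw [← Finset.sum_sub_distrib]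
  refine Finset.sum_congr rfl fun i _ => ?_
  rw [← hs i]
  simp only [star_mul', star_sub, star_one, Complex.star_def, Complex.conj_ofReal]
  ring

end Schur

/-! ### Second moments of discrete Gaussians -/

section Gaussian

theorem tsum_int_half_le (f : ℝ → ENNReal) (hf : ∀ a b, |a| ≤ |b| → f b ≤ f a) :
    ∑' k : ℤ, f (k / 2) ≤ 4 * ∑' k : ℤ, f k := by
  rw [← (Int.divModEquiv 2).symm.tsum_eq, ENNReal.tsum_prod']
  have h1 : ∀ j : ℤ, ∑' b : Fin 2, f ((((Int.divModEquiv 2).symm (j, b) : ℤ) : ℝ) / 2)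
      ≤ 2 * f j + (f j + f (j + 1 : ℤ)) := by
    intro j
    rw [tsum_fintype, Fin.sum_univ_two]
    have e0 : ((((Int.divModEquiv 2).symm (j, 0) : ℤ) : ℝ) / 2) = j := by
      simp [Int.divModEquiv]
    have e1 : ((((Int.divModEquiv 2).symm (j, 1) : ℤ) : ℝ) / 2) = j + 1 / 2 := by
      simp [Int.divModEquiv]
      ring
    rw [e0, e1]
    refine add_le_add ?_ ?_
    · rw [two_mul]
      exact le_self_add
    · rcases le_or_gt 0 j with hj | hj
      · refine (hf _ _ ?_).trans (le_self_add : f j ≤ _)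
        have : (0 : ℝ) ≤ j := by exact_mod_cast hj
        rw [abs_of_nonneg this, abs_of_nonneg (by positivity)]
        linarith
      · refine (hf _ _ ?_).trans (le_add_self : f (j + 1 : ℤ) ≤ _)
        have : (j : ℝ) + 1 ≤ 0 := by exact_mod_cast hj
        push_cast
        rw [abs_of_nonpos this, abs_of_nonpos (by linarith)]
        linarith
  refine (ENNReal.tsum_le_tsum h1).trans ?_
  have hshift : ∑' j : ℤ, f (j + 1 : ℤ) = ∑' j : ℤ, f j :=
    (Equiv.addRight (1 : ℤ)).tsum_eq fun k : ℤ => f k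
  rw [ENNReal.tsum_add, ENNReal.tsum_add, ENNReal.tsum_mul_left, hshift]
  refine le_of_eq ?_
  ring

/-- The one-dimensional Gaussian weight. -/
def gaussianWeightInt (σ : ℝ) (k : ℤ) : ENNReal :=
  ENNReal.ofReal (Real.exp (-Real.pi * (k : ℝ) ^ 2 / σ ^ 2))

/-- The pointwise bound `t exp (-π t) ≤ exp (-π t / 4)` compares the second moment with the total
weight of the Gaussian of twice the width. -/
theorem tsum_gaussianWeightInt_mul_sq_le {σ : ℝ} (hσ : 0 < σ) :
    ∑' k : ℤ, gaussianWeightInt σ k * ENNReal.ofReal ((k : ℝ) ^ 2)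
      ≤ ENNReal.ofReal (4 * σ ^ 2) * ∑' k : ℤ, gaussianWeightInt σ k := by
  have h1 : ∀ k : ℤ, gaussianWeightInt σ k * ENNReal.ofReal ((k : ℝ) ^ 2)
      ≤ ENNReal.ofReal (σ ^ 2) *
        (fun x : ℝ => ENNReal.ofReal (Real.exp (-Real.pi * x ^ 2 / σ ^ 2))) (k / 2) := by
    intro k
    simp only [gaussianWeightInt]
    rw [← ENNReal.ofReal_mul (Real.exp_nonneg _), ← ENNReal.ofReal_mul (by positivity)]
    apply ENNReal.ofReal_le_ofReal
    set t : ℝ := (k : ℝ) ^ 2 / σ ^ 2 with ht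
    have ht0 : 0 ≤ t := by positivity
    have e1 : (k : ℝ) ^ 2 = σ ^ 2 * t := by rw [ht]; field_simp
    have e2 : -Real.pi * (k : ℝ) ^ 2 / σ ^ 2 = -Real.pi * t := by rw [ht]; ring
    have e3 : -Real.pi * ((k : ℝ) / 2) ^ 2 / σ ^ 2 = -Real.pi * t + 3 / 4 * Real.pi * t := by
      rw [ht]; ring
    rw [e2, e3, e1, Real.exp_add]
    have h : t ≤ Real.exp (3 / 4 * Real.pi * t) := by
      have h1 := Real.add_one_le_exp (3 / 4 * Real.pi * t)
      have h2 := Real.pi_gt_three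
      nlinarith
    have h' := mul_le_mul_of_nonneg_left h
      (mul_nonneg (sq_nonneg σ) (Real.exp_nonneg (-Real.pi * t)))
    linarith
  refine (ENNReal.tsum_le_tsum h1).trans ?_
  rw [ENNReal.tsum_mul_left]
  have h2 := tsum_int_half_le
    (fun x : ℝ => ENNReal.ofReal (Real.exp (-Real.pi * x ^ 2 / σ ^ 2))) fun a b hab => by
    apply ENNReal.ofReal_le_ofReal
    apply Real.exp_le_exp.2
    have := sq_le_sq.2 hab
    have hpi := Real.pi_pos
    gcongr ?_ / _
    nlinarith
  refine (mul_le_mul_right h2 _).trans (le_of_eq ?_)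
  rw [ENNReal.ofReal_mul (by norm_num), ← mul_assoc, mul_comm (ENNReal.ofReal (σ ^ 2)) 4]
  rw [ENNReal.ofReal_ofNat]
  rfl

/-- Under the symmetry `k ↦ -k` the mixed term of the square disappears. -/
theorem tsum_gaussianWeightInt_mul_add_sq (σ y a : ℝ) :
    ∑' k : ℤ, gaussianWeightInt σ k * ENNReal.ofReal ((k * y + a) ^ 2)
      ≤ ENNReal.ofReal (y ^ 2) * ∑' k : ℤ, gaussianWeightInt σ k * ENNReal.ofReal ((k : ℝ) ^ 2)
        + ENNReal.ofReal (a ^ 2) * ∑' k : ℤ, gaussianWeightInt σ k := by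
  set T := ∑' k : ℤ, gaussianWeightInt σ k * ENNReal.ofReal ((k * y + a) ^ 2) with hT
  set R := ENNReal.ofReal (y ^ 2) * ∑' k : ℤ, gaussianWeightInt σ k * ENNReal.ofReal ((k : ℝ) ^ 2)
        + ENNReal.ofReal (a ^ 2) * ∑' k : ℤ, gaussianWeightInt σ k with hR
  have hR' : R = ∑' k : ℤ, gaussianWeightInt σ k * ENNReal.ofReal ((k * y) ^ 2 + a ^ 2) := by
    rw [hR, ← ENNReal.tsum_mul_left, ← ENNReal.tsum_mul_left, ← ENNReal.tsum_add]
    refine tsum_congr fun k => ?_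
    rw [ENNReal.ofReal_add (by positivity) (by positivity), mul_pow,
      ENNReal.ofReal_mul (by positivity)]
    ring
  have hT' : T = ∑' k : ℤ, gaussianWeightInt σ k * ENNReal.ofReal ((-(k : ℝ) * y + a) ^ 2) := by
    rw [hT, ← (Equiv.neg ℤ).tsum_eq]
    refine tsum_congr fun k => ?_
    simp [gaussianWeightInt]
  have h2 : T + T = R + R := by
    nth_rewrite 2 [hT']
    rw [hR', hT, ← ENNReal.tsum_add, ← ENNReal.tsum_add]
    refine tsum_congr fun k => ?_
    rw [← mul_add, ← mul_add, ← ENNReal.ofReal_add (by positivity) (by positivity),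
      ← ENNReal.ofReal_add (by positivity) (by positivity)]
    congr 2
    ring
  by_contra! hlt
  exact absurd h2 (ENNReal.add_lt_add hlt hlt).ne'

theorem gaussianWeight_cons (m : ℕ) (σ : ℝ) (k : ℤ) (x : Fin m → ℤ) :
    gaussianWeight (m + 1) σ ((Fin.consEquiv fun _ => ℤ) (k, x))
      = gaussianWeightInt σ k * gaussianWeight m σ x := by
  simp only [gaussianWeight, gaussianWeightInt, Fin.consEquiv, Equiv.coe_fn_mk, Fin.sum_univ_succ,
    Fin.cons_zero, Fin.cons_succ]
  rw [← ENNReal.ofReal_mul (Real.exp_nonneg _), ← Real.exp_add]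
  ring_nf

theorem tsum_gaussianWeight_mul_sq_le {σ : ℝ} (hσ : 0 < σ) (m : ℕ) (y : Fin m → ℝ) :
    ∑' x, gaussianWeight m σ x * ENNReal.ofReal ((∑ i, (x i : ℝ) * y i) ^ 2)
      ≤ ENNReal.ofReal (4 * σ ^ 2 * ∑ i, y i ^ 2) * ∑' x, gaussianWeight m σ x := by
  induction m with
  | zero => simp
  | succ m ih =>
    rw [← (Fin.consEquiv fun _ => ℤ).tsum_eq, ← (Fin.consEquiv fun _ => ℤ).tsum_eq
      (gaussianWeight (m + 1) σ), ENNReal.tsum_prod', ENNReal.tsum_prod', ENNReal.tsum_comm]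
    simp_rw [gaussianWeight_cons, ENNReal.tsum_mul_left, ENNReal.tsum_mul_right]
    set Z := ∑' k : ℤ, gaussianWeightInt σ k
    set Zm := ∑' x : Fin m → ℤ, gaussianWeight m σ x
    have h1 : ∀ x : Fin m → ℤ, ∑' k : ℤ, gaussianWeightInt σ k * gaussianWeight m σ x *
        ENNReal.ofReal ((∑ i, (((Fin.consEquiv fun _ => ℤ) (k, x) : Fin (m + 1) → ℤ) i : ℝ)
          * y i) ^ 2)
        ≤ gaussianWeight m σ x * (ENNReal.ofReal (y 0 ^ 2) * (ENNReal.ofReal (4 * σ ^ 2) * Z)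
          + ENNReal.ofReal ((∑ i, (x i : ℝ) * y i.succ) ^ 2) * Z) := by
      intro x
      calc _ = gaussianWeight m σ x * ∑' k : ℤ, gaussianWeightInt σ k *
            ENNReal.ofReal ((k * y 0 + ∑ i, (x i : ℝ) * y i.succ) ^ 2) := by
            rw [← ENNReal.tsum_mul_left]
            refine tsum_congr fun k => ?_
            simp only [Fin.consEquiv, Equiv.coe_fn_mk, Fin.sum_univ_succ, Fin.cons_zero,
              Fin.cons_succ]
            ring
        _ ≤ _ := by
            gcongr
            refine (tsum_gaussianWeightInt_mul_add_sq _ _ _).trans ?_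
            gcongr
            exact tsum_gaussianWeightInt_mul_sq_le hσ
    refine (ENNReal.tsum_le_tsum h1).trans ?_
    simp_rw [mul_add, ← mul_assoc]
    rw [ENNReal.tsum_add]
    simp_rw [ENNReal.tsum_mul_right]
    refine (add_le_add_right (mul_le_mul_left (ih fun i => y i.succ) Z) _).trans (le_of_eq ?_)
    rw [Fin.sum_univ_succ, mul_add, ENNReal.ofReal_add (by positivity) (by positivity),
      ENNReal.ofReal_mul (p := 4 * σ ^ 2) (q := y 0 ^ 2) (by positivity)]
    change Zm * _ * _ * Z + _ * Zm * Z = _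
    ring

end Gaussian

/-! ### Fourier transforms of distributions on `ℤ_q^m` -/

section Fourier

variable {m q : ℕ} [NeZero q]

/-- The Fourier transform of a distribution on `ℤ_q^m`. -/
def charSum (p : PMF (Fin m → ZMod q)) (z : Fin m → ZMod q) : ℂ :=
  ∑ e, ((p e).toReal : ℂ) * ZMod.stdAddChar (e ⬝ᵥ z)

theorem norm_stdAddChar (a : ZMod q) : ‖ZMod.stdAddChar a‖ = 1 := by
  rw [ZMod.stdAddChar_apply, Circle.norm_coe]

theorem star_stdAddChar (a : ZMod q) :
    star (ZMod.stdAddChar a) = ZMod.stdAddChar (-a) :=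
  (AddChar.map_neg_eq_conj ZMod.stdAddChar a).symm

theorem sum_pmf_toReal {α : Type} [Fintype α] (p : PMF α) : ∑ a, (p a).toReal = 1 := by
  rw [← ENNReal.toReal_sum fun a _ => p.apply_ne_top a, ← tsum_fintype (L := .unconditional _), PMF.tsum_coe,
    ENNReal.toReal_one]

theorem charSum_zero (p : PMF (Fin m → ZMod q)) : charSum p 0 = 1 := by
  have := sum_pmf_toReal p
  simp only [charSum, dotProduct_zero, AddChar.map_zero_eq_one, mul_one]
  exact_mod_cast this

theorem sum_bind_toReal_mul {α β : Type} [Fintype α] [Fintype β] (p : PMF α) (f : α → PMF β)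
    (h : β → ℂ) : ∑ b, ((p.bind f b).toReal : ℂ) * h b
      = ∑ a, ((p a).toReal : ℂ) * ∑ b, ((f a b).toReal : ℂ) * h b := by
  simp_rw [PMF.bind_apply, tsum_fintype]
  rw [Finset.sum_congr rfl fun b _ => by
    rw [ENNReal.toReal_sum fun a _ => ENNReal.mul_ne_top (p.apply_ne_top a) ((f a).apply_ne_top b)]]
  simp only [ENNReal.toReal_mul, Complex.ofReal_sum, Complex.ofReal_mul, Finset.sum_mul,
    Finset.mul_sum]
  rw [Finset.sum_comm]
  simp only [mul_assoc]

theorem sum_pure_toReal_mul {β : Type} [Fintype β] (a : β) (h : β → ℂ) :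
    ∑ b, ((PMF.pure a b).toReal : ℂ) * h b = h a := by
  classical
  rw [Finset.sum_eq_single a] <;> simp +contextual [PMF.pure_apply]

theorem sum_map_toReal_mul {α β : Type} [Fintype α] [Fintype β] (p : PMF α) (f : α → β)
    (h : β → ℂ) : ∑ b, ((p.map f b).toReal : ℂ) * h b = ∑ a, ((p a).toReal : ℂ) * h (f a) := by
  rw [PMF.map, sum_bind_toReal_mul]
  simp only [Function.comp_apply, sum_pure_toReal_mul]

/-- Orthogonality of characters on `ℤ_q^k`. -/
theorem charSum_uniform {k : ℕ} (d : Fin k → ZMod q) :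
    charSum (PMF.uniformOfFintype (Fin k → ZMod q)) d = if d = 0 then 1 else 0 := by
  split_ifs with hd
  · rw [hd, charSum_zero]
  · let ψ : AddChar (Fin k → ZMod q) ℂ :=
      { toFun := fun r => ZMod.stdAddChar (r ⬝ᵥ d)
        map_zero_eq_one' := by simp
        map_add_eq_mul' := fun r s => by rw [add_dotProduct, AddChar.map_add_eq_mul] }
    have hψ : ψ ≠ 0 := by
      obtain ⟨i, hi⟩ := Function.ne_iff.1 hd
      refine AddChar.ne_zero_iff.2 ⟨Pi.single i 1, fun h => hi ?_⟩
      refine ZMod.injective_stdAddChar ?_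
      rw [Pi.zero_apply, AddChar.map_zero_eq_one]
      simpa [ψ] using h
    have := AddChar.sum_eq_zero_iff_ne_zero.2 hψ
    simp only [charSum, PMF.uniformOfFintype_apply]
    rw [← Finset.mul_sum]
    exact mul_eq_zero_of_right _ this

/-- The reduction modulo `q` of the discrete Gaussian distribution on `ℤ^m`. -/
def noiseDist (m q : ℕ) (σ : ℝ) (hσ : 0 < σ) : PMF (Fin m → ZMod q) :=
  (discreteGaussian m σ hσ).map fun e i => (e i : ZMod q)

/-- Testing `B r + e` with the frequency `z` gives the noise transform if `z` is orthogonal to the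
columns of `B`, and zero otherwise. -/
theorem charSum_noisyImage {k : ℕ} {σ : ℝ} (hσ : 0 < σ) (B : Matrix (Fin m) (Fin k) (ZMod q))
    (z : Fin m → ZMod q) : charSum (noisyImage σ hσ B) z
      = if Bᵀ *ᵥ z = 0 then charSum (noiseDist m q σ hσ) z else 0 := by
  have h : noisyImage σ hσ B = (PMF.uniformOfFintype (Fin k → ZMod q)).bind fun r =>
      (noiseDist m q σ hσ).map fun e => B *ᵥ r + e := by
    simp only [noisyImage, noiseDist, PMF.map_comp]
    rfl
  have h2 : ∀ r : Fin k → ZMod q, (B *ᵥ r) ⬝ᵥ z = r ⬝ᵥ (Bᵀ *ᵥ z) := fun r => by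
    rw [dotProduct_mulVec, vecMul_transpose]
  rw [charSum, h, sum_bind_toReal_mul]
  simp_rw [sum_map_toReal_mul, add_dotProduct, AddChar.map_add_eq_mul, h2, mul_left_comm _
    (ZMod.stdAddChar (_ ⬝ᵥ (Bᵀ *ᵥ z))) _, ← Finset.mul_sum, ← mul_assoc]
  rw [← Finset.sum_mul]
  have := charSum_uniform (Bᵀ *ᵥ z)
  rw [charSum] at this
  rw [this, ite_mul, one_mul, zero_mul]
  rfl

/-- A signed combination of shifts of total weight at most `2 ^ K` whose transform is the geometric
sum `∑ i < K, (1 - g) ^ i`, an approximate inverse of the transform `g` of `p`. -/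
theorem exists_approx_inverse (p : PMF (Fin m → ZMod q)) (K : ℕ) :
    ∃ ν : (Fin m → ZMod q) → ℝ, ∑ t, |ν t| ≤ 2 ^ K - 1 ∧
      ∀ z, charSum p z * ∑ t, (ν t : ℂ) * ZMod.stdAddChar (t ⬝ᵥ z) = 1 - (1 - charSum p z) ^ K := by
  induction K with
  | zero => exact ⟨0, by simp, by simp⟩
  | succ K ih =>
    obtain ⟨ν, h1, h2⟩ := ih
    refine ⟨fun t => (if t = 0 then 1 else 0) + ν t - ∑ s, (p s).toReal * ν (t - s), ?_, ?_⟩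
    · have h3 : ∑ t, ∑ s, (p s).toReal * |ν (t - s)| = ∑ t, |ν t| := by
        rw [Finset.sum_comm]
        simp_rw [← Finset.mul_sum]
        have : ∀ s, ∑ t, |ν (t - s)| = ∑ t, |ν t| := fun s =>
          (Equiv.subRight s).sum_comp fun t => |ν t|
        simp_rw [this, ← Finset.sum_mul, sum_pmf_toReal, one_mul]
      calc _ ≤ ∑ t, ((if t = 0 then 1 else 0) + |ν t| + ∑ s, (p s).toReal * |ν (t - s)|) := by
            refine Finset.sum_le_sum fun t _ => ?_
            refine (abs_sub _ _).trans (add_le_add ((abs_add_le _ _).trans (add_le_add ?_ le_rfl)) ?_)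
            · split_ifs <;> simp
            · refine (Finset.abs_sum_le_sum_abs _ _).trans (Finset.sum_le_sum fun s _ => ?_)
              rw [abs_mul, abs_of_nonneg ENNReal.toReal_nonneg]
        _ = 1 + ∑ t, |ν t| + ∑ t, |ν t| := by
            rw [Finset.sum_add_distrib, Finset.sum_add_distrib, h3]
            simp
        _ ≤ _ := by rw [pow_succ]; linarith
    · intro z
      have h3 : ∑ t, (∑ s, ((p s).toReal : ℂ) * (ν (t - s) : ℂ)) * ZMod.stdAddChar (t ⬝ᵥ z)
          = charSum p z * ∑ t, (ν t : ℂ) * ZMod.stdAddChar (t ⬝ᵥ z) := by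
        simp_rw [Finset.sum_mul]
        rw [Finset.sum_comm, charSum, Finset.sum_mul]
        refine Finset.sum_congr rfl fun s _ => ?_
        rw [← Equiv.sum_comp (Equiv.addRight s), Finset.mul_sum]
        refine Finset.sum_congr rfl fun t _ => ?_
        simp only [Equiv.coe_addRight, add_sub_cancel_right, add_dotProduct,
          AddChar.map_add_eq_mul]
        ring
      have h4 : ∑ t, (((if t = 0 then 1 else 0) + ν t - ∑ s, (p s).toReal * ν (t - s) : ℝ) : ℂ)
          * ZMod.stdAddChar (t ⬝ᵥ z) = 1 + ∑ t, (ν t : ℂ) * ZMod.stdAddChar (t ⬝ᵥ z)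
            - charSum p z * ∑ t, (ν t : ℂ) * ZMod.stdAddChar (t ⬝ᵥ z) := by
        rw [← h3]
        push_cast
        simp only [sub_mul, add_mul, Finset.sum_sub_distrib, Finset.sum_add_distrib]
        congr 2
        rw [Finset.sum_eq_single 0] <;> simp +contextual
      rw [h4]
      linear_combination (1 - charSum p z) * h2 z

theorem norm_one_sub_stdAddChar_intCast_le (j : ℤ) :
    ‖1 - ZMod.stdAddChar (j : ZMod q)‖ ≤ |2 * Real.pi * j / q| := by
  have h : ZMod.stdAddChar (j : ZMod q)
      = Complex.exp (Complex.I * ((2 * Real.pi * j / q : ℝ) : ℂ)) := by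
    rw [ZMod.stdAddChar_coe]
    congr 1
    push_cast
    ring
  rw [h, norm_sub_rev, ← Real.norm_eq_abs]
  exact Real.norm_exp_I_mul_ofReal_sub_one_le

/-- The noise is nearly orthogonal, modulo `q`, to short vectors. -/
theorem sum_noiseDist_mul_le {σ : ℝ} (hσ : 0 < σ) (y : Fin m → ZMod q) :
    ∑ e, (noiseDist m q σ hσ e).toReal * ‖1 - ZMod.stdAddChar (e ⬝ᵥ y)‖ ^ 2
      ≤ (4 * Real.pi * (euclLength y * σ / q)) ^ 2 := by
  set c : ℝ := (2 * Real.pi / q) ^ 2 with hc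
  set yr : Fin m → ℝ := fun i => ((y i).valMinAbs : ℝ) with hyr
  have hpt : ∀ x : Fin m → ℤ, ‖1 - ZMod.stdAddChar ((fun i => (x i : ZMod q)) ⬝ᵥ y)‖ ^ 2
      ≤ c * (∑ i, (x i : ℝ) * yr i) ^ 2 := by
    intro x
    have e : (fun i => (x i : ZMod q)) ⬝ᵥ y = ((∑ i, x i * (y i).valMinAbs : ℤ) : ZMod q) := by
      simp [dotProduct]
    have e2 : ∑ i, (x i : ℝ) * yr i = ((∑ i, x i * (y i).valMinAbs : ℤ) : ℝ) := by
      simp [hyr]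
    rw [e, e2, hc, ← mul_pow]
    refine (pow_le_pow_left₀ (norm_nonneg _) (norm_one_sub_stdAddChar_intCast_le _) 2).trans ?_
    rw [sq_abs]
    refine le_of_eq ?_
    ring
  have hE : ∑ e, noiseDist m q σ hσ e *
      ENNReal.ofReal (‖1 - ZMod.stdAddChar (e ⬝ᵥ y)‖ ^ 2)
      ≤ ENNReal.ofReal (c * (4 * σ ^ 2 * ∑ i, yr i ^ 2)) := by
    have h1 : ∑ e, noiseDist m q σ hσ e * ENNReal.ofReal (‖1 - ZMod.stdAddChar (e ⬝ᵥ y)‖ ^ 2)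
        = ∑' x, discreteGaussian m σ hσ x * ENNReal.ofReal
          (‖1 - ZMod.stdAddChar ((fun i => (x i : ZMod q)) ⬝ᵥ y)‖ ^ 2) := by
      classical
      simp_rw [noiseDist, PMF.map_apply, ← ENNReal.tsum_mul_right]
      rw [← tsum_fintype (L := .unconditional _), ENNReal.tsum_comm]
      refine tsum_congr fun x => ?_
      rw [tsum_eq_single fun i => (x i : ZMod q)]
      · simp
      · intro b hb
        simp [hb]
    rw [h1]
    set Z := ∑' x, gaussianWeight m σ x with hZ
    have hZ0 := gaussianWeight_tsum_ne_zero m σ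
    have hZt := gaussianWeight_tsum_ne_top m σ hσ
    calc _ ≤ ∑' x, gaussianWeight m σ x * Z⁻¹ *
          (ENNReal.ofReal c * ENNReal.ofReal ((∑ i, (x i : ℝ) * yr i) ^ 2)) := by
          refine ENNReal.tsum_le_tsum fun x => ?_
          rw [discreteGaussian, PMF.normalize_apply, ← ENNReal.ofReal_mul (by positivity)]
          gcongr
          exact hpt x
      _ = ENNReal.ofReal c * Z⁻¹ *
          ∑' x, gaussianWeight m σ x * ENNReal.ofReal ((∑ i, (x i : ℝ) * yr i) ^ 2) := by
          rw [← ENNReal.tsum_mul_left]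
          refine tsum_congr fun x => ?_
          ring
      _ ≤ ENNReal.ofReal c * Z⁻¹ * (ENNReal.ofReal (4 * σ ^ 2 * ∑ i, yr i ^ 2) * Z) := by
          gcongr
          exact tsum_gaussianWeight_mul_sq_le hσ m yr
      _ = _ := by
          rw [ENNReal.ofReal_mul (p := c) (by positivity), mul_assoc, mul_left_comm Z⁻¹,
            ENNReal.inv_mul_cancel hZ0 hZt, mul_one]
  have h2 := ENNReal.toReal_mono ENNReal.ofReal_ne_top hE
  rw [ENNReal.toReal_ofReal (by positivity), ENNReal.toReal_sum fun e _ =>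
    ENNReal.mul_ne_top ((noiseDist m q σ hσ).apply_ne_top e) ENNReal.ofReal_ne_top] at h2
  simp only [ENNReal.toReal_mul, ENNReal.toReal_ofReal (sq_nonneg _)] at h2
  refine h2.trans (le_of_eq ?_)
  have h3 : euclLength y ^ 2 = ∑ i, yr i ^ 2 := Real.sq_sqrt (by positivity)
  rw [← h3, hc]
  ring

end Fourier

/-! ### Binary encodings -/

section Encoding

theorem sum_ite_testBit {R : Type} [CommSemiring R] (k x : ℕ) (hx : x < 2 ^ k) :
    ∑ j : Fin k, (if x.testBit j = true then (2 : R) ^ (j : ℕ) else 0) = x := by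
  induction k generalizing x with
  | zero => simp_all
  | succ k ih =>
    have h := ih (x / 2) (by rw [pow_succ] at hx; omega)
    rw [Fin.sum_univ_succ]
    have e : ∀ j : Fin k, (if x.testBit (j.succ : Fin (k + 1)) = true then
        (2 : R) ^ ((j.succ : Fin (k + 1)) : ℕ) else 0)
        = 2 * if (x / 2).testBit j = true then (2 : R) ^ (j : ℕ) else 0 := by
      intro j
      rw [Fin.val_succ, Nat.testBit_succ, pow_succ', mul_ite, mul_zero]
    simp_rw [e, ← Finset.mul_sum]
    rw [h]
    have hx2 : (x : R) = 2 * ((x / 2 : ℕ) : R) + ((x % 2 : ℕ) : R) := by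
      exact_mod_cast congrArg (Nat.cast (R := R)) (Nat.div_add_mod x 2).symm
    rw [hx2, add_comm]
    congr 1
    rcases Nat.mod_two_eq_zero_or_one x with h2 | h2 <;> simp [Nat.testBit_zero, h2]

theorem decVec_encVec {m q : ℕ} [NeZero q] (v : Fin m → ZMod q) : decVec (encVec v) = v := by
  funext i
  have h := sum_ite_testBit (R := ZMod q) (Nat.size q) (v i).val
    ((ZMod.val_lt _).trans (Nat.lt_size_self q))
  rw [ZMod.natCast_zmod_val] at h
  exact h

theorem encVec_injective {m q : ℕ} [NeZero q] :
    Function.Injective (encVec : (Fin m → ZMod q) → VecLabel m q → Bool) :=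
  Function.LeftInverse.injective decVec_encVec

theorem stdAddChar_sum {q : ℕ} [NeZero q] {ι : Type} (s : Finset ι) (f : ι → ZMod q) :
    (ZMod.stdAddChar (∑ p ∈ s, f p) : ℂ) = ∏ p ∈ s, (ZMod.stdAddChar (f p) : ℂ) := by
  classical
  induction s using Finset.induction_on with
  | empty => simp
  | insert a s ha ih =>
    rw [Finset.sum_insert ha, Finset.prod_insert ha, AddChar.map_add_eq_mul, ih]

/-- The character `b ⬝ᵥ y` as a product over pairs of bits of `b` and `y`. -/
theorem stdAddChar_decVec_dotProduct {m q : ℕ} [NeZero q] (b y : VecLabel m q → Bool) :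
    (ZMod.stdAddChar (decVec b ⬝ᵥ decVec y) : ℂ)
      = ∏ p : (Fin m × Fin (Nat.size q)) × Fin (Nat.size q),
        if b (p.1.1, p.2) && y p.1 then
          (ZMod.toCircle ((2 : ZMod q) ^ (p.2 : ℕ) * 2 ^ (p.1.2 : ℕ)) : ℂ) else 1 := by
  have h : decVec b ⬝ᵥ decVec y = ∑ p : (Fin m × Fin (Nat.size q)) × Fin (Nat.size q),
      if b (p.1.1, p.2) && y p.1 then ((2 : ZMod q) ^ (p.2 : ℕ) * 2 ^ (p.1.2 : ℕ)) else 0 := by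
    simp only [dotProduct, decVec, Fintype.sum_prod_type, Finset.sum_mul_sum]
    refine Finset.sum_congr rfl fun i _ => ?_
    rw [Finset.sum_comm]
    refine Finset.sum_congr rfl fun j _ => Finset.sum_congr rfl fun j' _ => ?_
    by_cases h1 : b (i, j') <;> by_cases h2 : y (i, j) <;> simp [h1, h2]
  rw [h]
  rw [stdAddChar_sum]
  refine Finset.prod_congr rfl fun p _ => ?_
  split_ifs
  · rw [ZMod.stdAddChar_apply]
  · exact AddChar.map_zero_eq_one _

end Encoding

/-! ### The reduction -/

section Reduction

variable {n m ℓ q : ℕ} [NeZero q]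

/-- The factor by which the reduction multiplies a basis state of the minter's registers: the
character of `b ⬝ᵥ y`, and the phases `d` for those bits of the `u`- and `y`-registers that are
set. -/
def Minter.twist (G : Minter n m ℓ q) (d : VecLabel n q ⊕ VecLabel m q → Circle)
    (b : Fin m → ZMod q) (x : G.Label → Bool) : ℂ :=
  ZMod.stdAddChar (b ⬝ᵥ decVec (G.yBits x)) * ∏ v, if x (Sum.inr (Sum.inl v)) then (d v : ℂ) else 1

/-- The qubits of the reduction: the key, the registers of the minter, the workspace of the verifier,
and the sample. -/
abbrev SimLabel (G : Minter n m ℓ q) (V : Decider (KeyLabel n m ℓ q ⊕ G.Label)) :=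
  ((KeyLabel n m ℓ q ⊕ G.Label) ⊕ Fin V.work) ⊕ VecLabel m q

variable (G : Minter n m ℓ q) (V : Decider (KeyLabel n m ℓ q ⊕ G.Label))
  (d : VecLabel n q ⊕ VecLabel m q → Circle)

/-- Copies the key into the input register of the minter. -/
def copyCircuit : Circuit (SimLabel G V) :=
  (Finset.univ : Finset (KeyLabel n m ℓ q)).toList.map fun i =>
    cnotGate (Sum.inl (Sum.inl (Sum.inl i))) (Sum.inl (Sum.inl (Sum.inr (Sum.inl i)))) (by simp)

/-- Runs the minter. -/
def mintCircuit : Circuit (SimLabel G V) :=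
  Circuit.map Function.Embedding.inl
    (Circuit.map Function.Embedding.inl (Circuit.map Function.Embedding.inr G.circuit))

/-- Multiplies by the character of `b ⬝ᵥ y`. -/
def characterCircuit : Circuit (SimLabel G V) :=
  (Finset.univ : Finset ((Fin m × Fin (Nat.size q)) × Fin (Nat.size q))).toList.map fun p =>
    controlledPhaseGate (Sum.inr (p.1.1, p.2))
      (Sum.inl (Sum.inl (Sum.inr (Sum.inr (Sum.inl (Sum.inr p.1)))))) (by simp)
      (ZMod.toCircle ((2 : ZMod q) ^ (p.2 : ℕ) * 2 ^ (p.1.2 : ℕ)))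

/-- Multiplies by the phases `d`. -/
def adviceCircuit : Circuit (SimLabel G V) :=
  (Finset.univ : Finset (VecLabel n q ⊕ VecLabel m q)).toList.map fun v =>
    phaseGate (Sum.inl (Sum.inl (Sum.inr (Sum.inr (Sum.inl v))))) (d v)

/-- The circuit of the reduction, on its own labelling of the qubits. -/
def simCircuit : Circuit (SimLabel G V) :=
  copyCircuit G V ++ (mintCircuit G V ++ (characterCircuit G V ++ (adviceCircuit G V d ++
    Circuit.map Function.Embedding.inl V.circuit)))

/-- Regrouping of the qubits into the input register and the workspace of the reduction. -/
def sumRegroup (α β γ δ : Type) : ((α ⊕ β) ⊕ γ) ⊕ δ ≃ (α ⊕ δ) ⊕ (β ⊕ γ) where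
  toFun := Sum.elim (Sum.elim (Sum.elim (Sum.inl ∘ Sum.inl) (Sum.inr ∘ Sum.inl))
    (Sum.inr ∘ Sum.inr)) (Sum.inl ∘ Sum.inr)
  invFun := Sum.elim (Sum.elim (Sum.inl ∘ Sum.inl ∘ Sum.inl) Sum.inr)
    (Sum.elim (Sum.inl ∘ Sum.inl ∘ Sum.inr) (Sum.inl ∘ Sum.inr))
  left_inv := by rintro (((_ | _) | _) | _) <;> rfl
  right_inv := by rintro ((_ | _) | (_ | _)) <;> rfl

/-- The labelling of the qubits of the reduction as those of a decision procedure. -/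
def simEquiv : SimLabel G V ≃
    (KeyLabel n m ℓ q ⊕ VecLabel m q) ⊕ Fin (Fintype.card (G.Label ⊕ Fin V.work)) :=
  (sumRegroup _ _ _ _).trans (Equiv.sumCongr (Equiv.refl _) (Fintype.equivFin _))

/-- The reduction: a distinguisher for samples `b` which runs the minter on a copy of the key,
multiplies the amplitude at `y` by the character of `b ⬝ᵥ y` and by the phases `d`, and runs the
verifier on the result. -/
def simulate : Decider (KeyLabel n m ℓ q ⊕ VecLabel m q) where
  work := Fintype.card (G.Label ⊕ Fin V.work)
  circuit := Circuit.map (simEquiv G V).toEmbedding (simCircuit G V d)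
  out := simEquiv G V (Sum.inl V.out)

theorem size_simulate : (simulate G V d).size =
    (m * ℓ * Nat.size q + m * n * Nat.size q) + G.size + m * Nat.size q * Nat.size q
      + (n * Nat.size q + m * Nat.size q) + V.size
      + ((m * ℓ * Nat.size q + m * n * Nat.size q) + (n * Nat.size q + m * Nat.size q)) := by
  simp only [Decider.size, Generator.size, simulate, Circuit.length_map, simCircuit, copyCircuit,
    mintCircuit, characterCircuit, adviceCircuit, List.length_append, List.length_map,
    Finset.length_toList, Finset.card_univ, Fintype.card_sum, Fintype.card_prod, Fintype.card_fin]
  ring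

theorem run_simCircuit (s : KeyLabel n m ℓ q → Bool) (b : Fin m → ZMod q) :
    (simCircuit G V d).run (ket (Sum.elim (Sum.elim (Sum.elim s fun _ => false) fun _ => false)
      (encVec b)))
    = tensor (V.circuit.run (tensor (tensor (ket s) fun x => G.twist d b x * G.output s x)
        (ket fun _ => false))) (ket (encVec b)) := by
  have h1 : (copyCircuit G V).run
      (ket (Sum.elim (Sum.elim (Sum.elim s fun _ => false) fun _ => false) (encVec b)))
      = tensor (tensor (tensor (ket s) (tensor (ket s) (ket fun _ => false)))
        (ket fun _ => false)) (ket (encVec b)) := by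
    rw [← ket_sum_elim s, ← ket_sum_elim s, ← ket_sum_elim _ fun _ => false, ← ket_sum_elim]
    refine run_cnot_toList_ket _ _ (by simp) (fun i j h => by simpa using h) _ _ (by simp)
      (by simp) ?_
    rintro (((p | (p | p)) | p) | p) hp
    · rfl
    · exact absurd rfl (hp p)
    · rfl
    · rfl
    · rfl
  have h2 : (mintCircuit G V).run (tensor (tensor (tensor (ket s)
      (tensor (ket s) (ket fun _ => false))) (ket fun _ => false)) (ket (encVec b)))
      = tensor (tensor (tensor (ket s) (G.output s)) (ket fun _ => false)) (ket (encVec b)) := by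
    rw [mintCircuit, Circuit.run_map_inl, Circuit.run_map_inl, Circuit.run_map_inr]
    rfl
  have h3 : (adviceCircuit G V d).run ((characterCircuit G V).run
      (tensor (tensor (tensor (ket s) (G.output s)) (ket fun _ => false)) (ket (encVec b))))
      = tensor (tensor (tensor (ket s) fun x => G.twist d b x * G.output s x)
        (ket fun _ => false)) (ket (encVec b)) := by
    rw [characterCircuit, run_map_toList_of_diag _ _ fun p ψ => controlledPhaseGate_apply ..,
      adviceCircuit, run_map_toList_of_diag _ _ fun p ψ => phaseGate_apply ..]
    funext x
    by_cases hx : x ∘ Sum.inr = encVec b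
    · have hb : ∀ p, x (Sum.inr p) = encVec b p := fun p => congrFun hx p
      have hchar := stdAddChar_decVec_dotProduct (encVec b)
        (G.yBits (((x ∘ Sum.inl) ∘ Sum.inl) ∘ Sum.inr))
      rw [decVec_encVec] at hchar
      simp only [← hb] at hchar
      refine (congrArg₂ (· * ·) rfl (congrArg₂ (· * ·) hchar.symm rfl)).trans ?_
      simp only [tensor, Minter.twist, Function.comp_apply]
      ring
    · simp [tensor, ket_apply, hx]
  rw [simCircuit, Circuit.run_append, Circuit.run_append, Circuit.run_append, Circuit.run_append,
    h1, h2, h3, Circuit.run_map_inl]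

theorem acceptProb_simulate (s : KeyLabel n m ℓ q → Bool) (b : Fin m → ZMod q) :
    (simulate G V d).acceptProb (ket (Sum.elim s (encVec b)))
      = V.acceptProb (tensor (ket s) fun x => G.twist d b x * G.output s x) := by
  have hket : ∀ Z, (fun r : SimLabel G V → Bool => ket Z (r ∘ (simEquiv G V).symm))
      = ket (Z ∘ simEquiv G V) := by
    intro Z
    funext r
    rw [ket_apply, ket_apply]
    congr 1
    rw [eq_iff_iff]
    constructor
    · rintro rfl
      simp [Function.comp_assoc]
    · rintro rfl
      simp [Function.comp_assoc]
  have hstart : (Sum.elim (Sum.elim s (encVec b)) fun _ => false) ∘ simEquiv G V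
      = Sum.elim (Sum.elim (Sum.elim s fun _ => false) fun _ => false) (encVec b) := by
    funext p
    rcases p with (((p | p) | p) | p) <;> rfl
  change (∑ x : (KeyLabel n m ℓ q ⊕ VecLabel m q) ⊕ Fin (Fintype.card (G.Label ⊕ Fin V.work))
      → Bool, if x (simEquiv G V (Sum.inl V.out)) = true then
      ‖(Circuit.map (simEquiv G V).toEmbedding (simCircuit G V d)).run
        (tensor (ket (Sum.elim s (encVec b))) (ket fun _ => false)) x‖ ^ 2 else 0) = _
  rw [← ket_sum_elim, Circuit.run_map_equiv, hket, hstart, run_simCircuit]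
  refine (Equiv.sum_comp (Equiv.arrowCongr (simEquiv G V).symm (Equiv.refl Bool))
    fun r : SimLabel G V → Bool => if r (Sum.inl V.out) = true then
      ‖tensor (V.circuit.run (tensor (tensor (ket s) fun x => G.twist d b x * G.output s x)
        (ket fun _ => false))) (ket (encVec b)) r‖ ^ 2 else 0).trans ?_
  rw [sum_bool_sum, Decider.acceptProb]
  refine Finset.sum_congr rfl fun v _ => ?_
  rw [Finset.sum_eq_single (encVec b)]
  · simp [tensor, ket_apply]
  · intro c _ hc
    simp [tensor, ket_apply, hc]
  · simp

end Reduction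

/-! ### Acceptance probabilities as quadratic forms -/

section Forms

variable {ι κ : Type} [Fintype ι] [DecidableEq ι] [Fintype κ] [DecidableEq κ]
  (V : Decider (ι ⊕ κ)) (s : ι → Bool)

/-- The final state of `V` on the classical input `s` and the quantum input `φ`. -/
def Decider.final (φ : State κ) : State ((ι ⊕ κ) ⊕ Fin V.work) :=
  V.circuit.run (tensor (tensor (ket s) φ) (ket fun _ => false))

/-- The matrix of the quadratic form `φ ↦ V.acceptProb (|s⟩ ⊗ φ)`. -/
def Decider.form (x x' : κ → Bool) : ℂ :=
  ∑ w, if w V.out = true then star (V.final s (ket x) w) * V.final s (ket x') w else 0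

theorem Decider.final_apply (φ : State κ) (w : (ι ⊕ κ) ⊕ Fin V.work → Bool) :
    V.final s φ w = ∑ x, φ x * V.final s (ket x) w := by
  have h : tensor (tensor (ket s) φ) (ket fun _ : Fin V.work => false)
      = ∑ x, φ x • tensor (tensor (ket s) (ket x)) (ket fun _ : Fin V.work => false) := by
    funext v
    rw [Finset.sum_apply, Finset.sum_eq_single ((v ∘ Sum.inl) ∘ Sum.inr)]
    · simp only [tensor, Pi.smul_apply, smul_eq_mul, ket_apply, if_true]
      ring
    · intro x _ hx
      simp [tensor, ket_apply, hx.symm]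
    · simp
  have h2 := congrArg (Circuit.runLinear V.circuit) h
  rw [map_sum] at h2
  simp only [map_smul] at h2
  have h3 := congrFun h2 w
  rw [Finset.sum_apply] at h3
  exact h3

theorem Decider.pairing_form (v v' : State κ) : pairing (V.form s) v v'
    = ∑ w, if w V.out = true then star (V.final s v w) * V.final s v' w else 0 := by
  simp only [pairing, Decider.form, Finset.mul_sum]
  rw [Finset.sum_congr rfl fun x _ => Finset.sum_comm, Finset.sum_comm]
  refine Finset.sum_congr rfl fun w _ => ?_
  split_ifs
  · rw [V.final_apply s v, V.final_apply s v', star_sum, Finset.sum_mul_sum]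
    refine Finset.sum_congr rfl fun x _ => Finset.sum_congr rfl fun x' _ => ?_
    rw [star_mul']
    ring
  · simp

theorem Decider.acceptProb_tensor_ket (φ : State κ) :
    (V.acceptProb (tensor (ket s) φ) : ℂ) = pairing (V.form s) φ φ := by
  rw [V.pairing_form, Decider.acceptProb, Complex.ofReal_sum]
  refine Finset.sum_congr rfl fun w _ => ?_
  split_ifs
  · rw [Complex.star_def, ← Complex.normSq_eq_conj_mul_self, Complex.normSq_eq_norm_sq]
    rfl
  · simp

theorem Decider.formBounded : FormBounded (V.form s) 1 := by
  intro v v'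
  have hn : ∀ φ : State κ, ∑ w, ‖V.final s φ w‖ ^ 2 = ∑ x, ‖φ x‖ ^ 2 := by
    intro φ
    rw [Decider.final, Circuit.sum_norm_sq_run, sum_norm_sq_tensor, sum_norm_sq_tensor,
      sum_norm_sq_ket, sum_norm_sq_ket, one_mul, mul_one]
  rw [V.pairing_form, one_mul, ← hn v, ← hn v']
  calc _ ≤ ∑ w, ‖V.final s v w‖ * ‖V.final s v' w‖ := by
        refine (norm_sum_le _ _).trans (Finset.sum_le_sum fun w _ => ?_)
        split_ifs
        · simp
        · simp only [norm_zero]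
          positivity
    _ = ∑ w, √(‖V.final s v w‖ ^ 2) * √(‖V.final s v' w‖ ^ 2) := by
        simp only [Real.sqrt_sq (norm_nonneg _)]
    _ ≤ _ := Real.sum_sqrt_mul_sqrt_le _ (fun w => by positivity) fun w => by positivity

/-- The quadratic form of `V` at `φ`, with the matrix entry at `(x, x')` multiplied by
`K x x'`. -/
def Decider.weighted (φ : State κ) (K : (κ → Bool) → (κ → Bool) → ℂ) : ℂ :=
  pairing (fun x x' => V.form s x x' * K x x') φ φ

variable (φ : State κ)

theorem Decider.weighted_sum {I : Type} [Fintype I] (c : I → ℂ)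
    (K : I → (κ → Bool) → (κ → Bool) → ℂ) :
    ∑ i, c i * V.weighted s φ (K i) = V.weighted s φ fun x x' => ∑ i, c i * K i x x' := by
  simp only [Decider.weighted, pairing, Finset.mul_sum]
  rw [Finset.sum_comm]
  refine Finset.sum_congr rfl fun x _ => ?_
  rw [Finset.sum_comm]
  refine Finset.sum_congr rfl fun x' _ => Finset.sum_congr rfl fun i _ => ?_
  ring

theorem Decider.weighted_add (K K' : (κ → Bool) → (κ → Bool) → ℂ) :
    V.weighted s φ (fun x x' => K x x' + K' x x') = V.weighted s φ K + V.weighted s φ K' := by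
  simp only [Decider.weighted, mul_add]
  rw [pairing_add]

theorem Decider.weighted_sub (K K' : (κ → Bool) → (κ → Bool) → ℂ) :
    V.weighted s φ (fun x x' => K x x' - K' x x') = V.weighted s φ K - V.weighted s φ K' := by
  simp only [Decider.weighted, pairing, mul_sub, Finset.sum_sub_distrib]

variable {φ} in
theorem Decider.weighted_congr {K K' : (κ → Bool) → (κ → Bool) → ℂ}
    (h : ∀ x x', φ x ≠ 0 → φ x' ≠ 0 → K x x' = K' x x') :
    V.weighted s φ K = V.weighted s φ K' := by
  refine Finset.sum_congr rfl fun x _ => Finset.sum_congr rfl fun x' _ => ?_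
  by_cases hx : φ x = 0
  · simp [hx]
  by_cases hx' : φ x' = 0
  · simp [hx']
  exact congrArg (fun z => star (φ x) * φ x' * (V.form s x x' * z)) (h x x' hx hx')

variable {φ} in
theorem Decider.norm_weighted_le {K : (κ → Bool) → (κ → Bool) → ℂ} {c : ℝ}
    (hK : SchurBounded K c) (hφ : ∑ x, ‖φ x‖ ^ 2 = 1) : ‖V.weighted s φ K‖ ≤ c := by
  have := hK _ _ zero_le_one (V.formBounded s) φ φ
  rw [hφ, Real.sqrt_one, mul_one, mul_one, mul_one] at this
  exact this

theorem Decider.acceptProb_mul (h : (κ → Bool) → ℂ) :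
    (V.acceptProb (tensor (ket s) fun x => h x * φ x) : ℂ)
      = V.weighted s φ fun x x' => star (h x) * h x' := by
  rw [V.acceptProb_tensor_ket]
  refine Finset.sum_congr rfl fun x _ => Finset.sum_congr rfl fun x' _ => ?_
  rw [star_mul']
  ring

/-- A partial measurement pinches the matrix of the state. -/
theorem Decider.acceptAfterMeasure_eq {α : Type} [Fintype α] [DecidableEq α]
    (f : (κ → Bool) → α) : (V.acceptAfterMeasure s φ f : ℂ)
      = V.weighted s φ fun x x' => if f x = f x' then 1 else 0 := by
  rw [Decider.acceptAfterMeasure, Complex.ofReal_sum]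
  have h : ∀ a, (V.acceptProb (tensor (ket s) fun x => if f x = a then φ x else 0) : ℂ)
      = 1 * V.weighted s φ fun x x' => (if f x = a then 1 else 0) * if f x' = a then 1 else 0 := by
    intro a
    have := V.acceptProb_mul s φ fun x => if f x = a then 1 else 0
    simpa [apply_ite] using this
  simp_rw [h]
  rw [V.weighted_sum s φ (fun _ : α => (1 : ℂ))]
  congr 1
  funext x x'
  simp [eq_comm]

end Forms

/-! ### The quantitative bound -/

section Quantitative

variable {n m ℓ q : ℕ} [NeZero q]

/-- The phases realising the character of `t ⬝ᵥ y` and the sign `(-1) ^ (c ⬝ᵥ u)`, where `u` is the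
bit string in the `u`-register. -/
def advice (t : Fin m → ZMod q) (c : VecLabel n q → Bool) :
    VecLabel n q ⊕ VecLabel m q → Circle :=
  Sum.elim (fun v => if c v then Circle.exp Real.pi else 1)
    fun p => ZMod.toCircle (t p.1 * 2 ^ (p.2 : ℕ))

/-- The sign `(-1) ^ (c ⬝ᵥ u)`. -/
def signChar {ι : Type} [Fintype ι] (c u : ι → Bool) : ℂ :=
  ∏ v, if u v then (if c v then -1 else 1) else 1

theorem sum_signChar_mul {ι : Type} [Fintype ι] [DecidableEq ι] (u u' : ι → Bool) :
    ∑ c : ι → Bool, ((2 : ℂ) ^ Fintype.card ι)⁻¹ * (star (signChar c u) * signChar c u')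
      = if u = u' then 1 else 0 := by
  have h : ∀ c : ι → Bool, star (signChar c u) * signChar c u'
      = ∏ v, (if u v then (if c v then (-1 : ℂ) else 1) else 1) *
        (if u' v then (if c v then -1 else 1) else 1) := by
    intro c
    rw [signChar, signChar, star_prod, Finset.prod_mul_distrib]
    congr 1
    refine Finset.prod_congr rfl fun v _ => ?_
    split_ifs <;> simp
  have h2 := Finset.prod_univ_sum (fun _ : ι => (Finset.univ : Finset Bool)) fun v b =>
    (if u v then (if b then (-1 : ℂ) else 1) else 1) * (if u' v then (if b then -1 else 1) else 1)
  rw [Fintype.piFinset_univ] at h2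
  rw [← Finset.mul_sum, Finset.sum_congr rfl fun c _ => h c, ← h2]
  have h3 : ∀ v, ∑ b : Bool, (if u v then (if b then (-1 : ℂ) else 1) else 1) *
      (if u' v then (if b then -1 else 1) else 1) = if u v = u' v then 2 else 0 := by
    intro v
    cases u v <;> cases u' v <;> norm_num
  simp_rw [h3]
  split_ifs with hu
  · subst hu
    simp
  · obtain ⟨v, hv⟩ := Function.ne_iff.1 hu
    rw [Finset.prod_eq_zero (Finset.mem_univ v) (if_neg hv), mul_zero]

theorem Minter.twist_advice (G : Minter n m ℓ q) (t : Fin m → ZMod q)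
    (c : VecLabel n q → Bool) (b : Fin m → ZMod q) (x : G.Label → Bool) :
    G.twist (advice t c) b x
      = ZMod.stdAddChar ((b + t) ⬝ᵥ decVec (G.yBits x)) * signChar c (G.uBits x) := by
  have h1 : ∏ p : VecLabel m q, (if x (Sum.inr (Sum.inl (Sum.inr p))) then
      (ZMod.toCircle (t p.1 * 2 ^ (p.2 : ℕ)) : ℂ) else 1)
      = ZMod.stdAddChar (t ⬝ᵥ decVec (G.yBits x)) := by
    have h2 : t ⬝ᵥ decVec (G.yBits x) = ∑ p : VecLabel m q,
        if x (Sum.inr (Sum.inl (Sum.inr p))) then t p.1 * 2 ^ (p.2 : ℕ) else 0 := by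
      simp only [dotProduct, decVec, Minter.yBits, Fintype.sum_prod_type, Finset.mul_sum]
      refine Finset.sum_congr rfl fun i _ => Finset.sum_congr rfl fun j _ => ?_
      by_cases h : x (Sum.inr (Sum.inl (Sum.inr (i, j)))) = true <;> simp [h]
    rw [h2, stdAddChar_sum]
    refine Finset.prod_congr rfl fun p _ => ?_
    split_ifs
    · rw [ZMod.stdAddChar_apply]
    · exact (AddChar.map_zero_eq_one _).symm
  rw [Minter.twist, Fintype.prod_sum_type, add_dotProduct, AddChar.map_add_eq_mul, ← h1]
  have h3 : ∏ v, (if x (Sum.inr (Sum.inl (Sum.inl v))) then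
      ((advice t c (Sum.inl v) : Circle) : ℂ) else 1) = signChar c (G.uBits x) := by
    refine Finset.prod_congr rfl fun v _ => ?_
    change (if x (Sum.inr (Sum.inl (Sum.inl v))) then
      ((if c v then Circle.exp Real.pi else 1 : Circle) : ℂ) else 1)
      = if x (Sum.inr (Sum.inl (Sum.inl v))) then (if c v then -1 else 1) else 1
    split_ifs <;> simp [Circle.coe_exp]
  rw [h3]
  simp only [advice, Sum.elim_inr]
  ring

variable (G : Minter n m ℓ q) (V : Decider (KeyLabel n m ℓ q ⊕ G.Label))

/-- The acceptance probability of the reduction on samples from `P`, averaged over the signs: these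
have the effect of measuring the `u`-register. -/
theorem sum_acceptProb_simulate (s : KeyLabel n m ℓ q → Bool) (P : PMF (Fin m → ZMod q))
    (t : Fin m → ZMod q) :
    ∑ c, ((2 : ℂ) ^ Fintype.card (VecLabel n q))⁻¹ * ∑ b, ((P b).toReal : ℂ) *
        ((simulate G V (advice t c)).acceptProb (ket (Sum.elim s (encVec b))) : ℂ)
      = V.weighted s (G.output s) fun x x' => (if G.uBits x = G.uBits x' then 1 else 0) *
        (ZMod.stdAddChar (t ⬝ᵥ (decVec (G.yBits x') - decVec (G.yBits x))) *
          charSum P (decVec (G.yBits x') - decVec (G.yBits x))) := by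
  simp_rw [acceptProb_simulate, V.acceptProb_mul, V.weighted_sum]
  congr 1
  funext x x'
  rw [← sum_signChar_mul, Finset.sum_mul]
  refine Finset.sum_congr rfl fun c _ => ?_
  rw [mul_assoc, charSum]
  congr 1
  simp_rw [Finset.mul_sum]
  refine Finset.sum_congr rfl fun b _ => ?_
  rw [G.twist_advice, G.twist_advice, star_mul', star_stdAddChar]
  have h : ZMod.stdAddChar (-((b + t) ⬝ᵥ decVec (G.yBits x))) *
      ZMod.stdAddChar ((b + t) ⬝ᵥ decVec (G.yBits x'))
      = ZMod.stdAddChar (t ⬝ᵥ (decVec (G.yBits x') - decVec (G.yBits x))) *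
        ZMod.stdAddChar (b ⬝ᵥ (decVec (G.yBits x') - decVec (G.yBits x))) := by
    rw [← AddChar.map_add_eq_mul, ← AddChar.map_add_eq_mul]
    congr 1
    simp only [dotProduct_sub, add_dotProduct]
    ring
  linear_combination ((P b).toReal : ℂ) * star (signChar c (G.uBits x)) *
    signChar c (G.uBits x') * h

/-- One minus the noise transform is a small Schur multiplier on short vectors. -/
theorem schurBounded_one_sub_charSum {X : Type} [Fintype X] {σ W : ℝ} (hσ : 0 < σ)
    (y : X → Fin m → ZMod q) (hy : ∀ x, euclLength (y x) ≤ W) (hW : 0 ≤ W) :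
    SchurBounded (fun x x' => 1 - charSum (noiseDist m q σ hσ) (y x' - y x))
      (2 * (4 * Real.pi * (W * σ / q))) := by
  have hpi := Real.pi_pos
  have h := SchurBounded.one_sub_gram (fun e => (noiseDist m q σ hσ e).toReal)
    (fun _ => ENNReal.toReal_nonneg) (sum_pmf_toReal _)
    (fun (x : X) e => ZMod.stdAddChar (e ⬝ᵥ y x)) (ε := 4 * Real.pi * (W * σ / q))
    (by positivity) (fun _ _ => norm_stdAddChar _) fun x => by
      refine (sum_noiseDist_mul_le hσ (y x)).trans ?_
      have := hy x
      have h0 : 0 ≤ euclLength (y x) := Real.sqrt_nonneg _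
      gcongr
  convert h using 4 with x x'
  rw [charSum]
  refine Finset.sum_congr rfl fun e _ => ?_
  rw [star_stdAddChar, ← AddChar.map_add_eq_mul, dotProduct_sub]
  congr 2
  ring

/-- Splits off from a kernel the part that is seen through the noise transform of `p`, using an
approximate inverse `ν` of that transform. -/
theorem Decider.weighted_eq_sum_add {ι κ : Type} [Fintype ι] [DecidableEq ι] [Fintype κ]
    [DecidableEq κ] (V : Decider (ι ⊕ κ)) (s : ι → Bool) (φ : State κ)
    (J : (κ → Bool) → (κ → Bool) → ℂ) (Y : (κ → Bool) → Fin m → ZMod q)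
    (p : PMF (Fin m → ZMod q)) (K : ℕ) (ν : (Fin m → ZMod q) → ℝ)
    (hν : ∀ z, charSum p z * ∑ t, (ν t : ℂ) * ZMod.stdAddChar (t ⬝ᵥ z)
      = 1 - (1 - charSum p z) ^ K) :
    V.weighted s φ J = ∑ t, (ν t : ℂ) * V.weighted s φ (fun x x' =>
        J x x' * (ZMod.stdAddChar (t ⬝ᵥ (Y x' - Y x)) * charSum p (Y x' - Y x)))
      + V.weighted s φ fun x x' => J x x' * (1 - charSum p (Y x' - Y x)) ^ K := by
  rw [V.weighted_sum, ← V.weighted_add]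
  refine V.weighted_congr _ fun x x' _ _ => ?_
  have h' : ∑ t, (ν t : ℂ) * (J x x' * (ZMod.stdAddChar (t ⬝ᵥ (Y x' - Y x)) *
      charSum p (Y x' - Y x))) = J x x' * (charSum p (Y x' - Y x) *
        ∑ t, (ν t : ℂ) * ZMod.stdAddChar (t ⬝ᵥ (Y x' - Y x))) := by
    simp only [Finset.mul_sum]
    refine Finset.sum_congr rfl fun t _ => ?_
    ring
  rw [h', hν]
  ring

/-- The indicator of the pairs of basis states with the same `u` and different values of `f S y`:
these are the matrix entries of the state that the measurement of `f S y` deletes. -/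
def Minter.offDiagonal {α : Type} [DecidableEq α]
    (f : Matrix (Fin m) (Fin ℓ) (ZMod q) → (Fin m → ZMod q) → α)
    (S : Matrix (Fin m) (Fin ℓ) (ZMod q)) (x x' : G.Label → Bool) : ℂ :=
  (if G.uBits x = G.uBits x' then 1 else 0) *
    (1 - if f S (decVec (G.yBits x)) = f S (decVec (G.yBits x')) then 1 else 0)

theorem Minter.schurBounded_offDiagonal {α : Type} [Fintype α] [DecidableEq α]
    (f : Matrix (Fin m) (Fin ℓ) (ZMod q) → (Fin m → ZMod q) → α)
    (S : Matrix (Fin m) (Fin ℓ) (ZMod q)) : SchurBounded (G.offDiagonal f S) 2 := by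
  have h := (SchurBounded.ite_eq G.uBits).mul zero_le_one
    (SchurBounded.ite_eq fun x => f S (decVec (G.yBits x))).one_sub
  have e : ((1 : ℝ) + 1) * 1 = 2 := by norm_num
  rw [e] at h
  unfold Minter.offDiagonal
  exact h

theorem acceptUnmeasured_sub_acceptMeasured {α : Type} [Fintype α] [DecidableEq α]
    (D : PMF (Matrix (Fin m) (Fin ℓ) (ZMod q)))
    (f : Matrix (Fin m) (Fin ℓ) (ZMod q) → (Fin m → ZMod q) → α) :
    ((acceptUnmeasured G V D - acceptMeasured G V D f : ℝ) : ℂ)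
      = ∑ k, ((keyDist n D k).toReal : ℂ) *
        V.weighted (encKey k) (G.output (encKey k)) (G.offDiagonal f k.1) := by
  rw [Complex.ofReal_sub, acceptUnmeasured, acceptMeasured, Complex.ofReal_sum, Complex.ofReal_sum,
    ← Finset.sum_sub_distrib]
  refine Finset.sum_congr rfl fun k _ => ?_
  rw [Complex.ofReal_mul, Complex.ofReal_mul, V.acceptAfterMeasure_eq, V.acceptAfterMeasure_eq,
    ← mul_sub, ← V.weighted_sub]
  refine congrArg _ (V.weighted_congr _ fun x x' _ _ => ?_)
  simp only [Minter.offDiagonal, Prod.mk.injEq, ite_and]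
  split_ifs <;> simp

/-- The advantage of the verifier against the measurement of `f S y` is at most `2 ^ K` times that of
the best of the reductions against the samples, up to an error that decays
geometrically in `K` once `W σ / q` is small. -/
theorem abs_acceptUnmeasured_sub_acceptMeasured_le {α : Type} [Fintype α] [DecidableEq α]
    {W σ : ℝ} (hW : 0 ≤ W) (hσ : 0 < σ) (D : PMF (Matrix (Fin m) (Fin ℓ) (ZMod q)))
    (hG : G.Admissible W D) (f : Matrix (Fin m) (Fin ℓ) (ZMod q) → (Fin m → ZMod q) → α)
    (P₁ P₂ : Matrix (Fin m) (Fin ℓ) (ZMod q) × Matrix (Fin m) (Fin n) (ZMod q) →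
      PMF (Fin m → ZMod q))
    (h₁ : ∀ k z, (k.2)ᵀ *ᵥ z = 0 → charSum (P₁ k) z = charSum (noiseDist m q σ hσ) z)
    (h₂ : ∀ k y y', charSum (P₂ k) (y' - y)
      = if f k.1 y = f k.1 y' then charSum (noiseDist m q σ hσ) (y' - y) else 0)
    (B : ℝ) (hB : ∀ t c, |sampleAcceptProb (simulate G V (advice t c)) (keyDist n D) P₁ -
      sampleAcceptProb (simulate G V (advice t c)) (keyDist n D) P₂| ≤ B) (K : ℕ) :
    |acceptUnmeasured G V D - acceptMeasured G V D f|
      ≤ 2 ^ K * B + 2 * (2 * (4 * Real.pi * (W * σ / q))) ^ K := by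
  set g := charSum (noiseDist m q σ hσ) with hg
  set Y : (G.Label → Bool) → Fin m → ZMod q := fun x => decVec (G.yBits x) with hY
  set J := G.offDiagonal f with hJ
  -- the contribution of the shift `t`: the difference of the two kinds of samples
  set δ : (Fin m → ZMod q) → ℂ := fun t => ∑ k, ((keyDist n D k).toReal : ℂ) *
    V.weighted (encKey k) (G.output (encKey k)) fun x x' =>
      J k.1 x x' * (ZMod.stdAddChar (t ⬝ᵥ (Y x' - Y x)) * g (Y x' - Y x)) with hδ
  have hsupp : ∀ k, keyDist n D k ≠ 0 → ∀ x, G.output (encKey k) x ≠ 0 →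
      G.uBits x = encVec ((k.2)ᵀ *ᵥ Y x) ∧ euclLength (Y x) ≤ W := by
    intro k hk x hx
    obtain ⟨u, y, hu, hy, huy, hle⟩ := hG k ((PMF.mem_support_iff _ _).2 hk) x hx
    have hYx : Y x = y := by rw [hY, ← decVec_encVec y, ← hy]
    rw [hYx, huy]
    exact ⟨hu, hle⟩
  have hδB : ∀ t, ‖δ t‖ ≤ B := by
    intro t
    have key : δ t = ∑ c, ((2 : ℂ) ^ Fintype.card (VecLabel n q))⁻¹ *
        ((sampleAcceptProb (simulate G V (advice t c)) (keyDist n D) P₁ -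
          sampleAcceptProb (simulate G V (advice t c)) (keyDist n D) P₂ : ℝ) : ℂ) := by
      have hP : ∀ P : Matrix (Fin m) (Fin ℓ) (ZMod q) × Matrix (Fin m) (Fin n) (ZMod q) →
          PMF (Fin m → ZMod q), ∑ c, ((2 : ℂ) ^ Fintype.card (VecLabel n q))⁻¹ *
            ((sampleAcceptProb (simulate G V (advice t c)) (keyDist n D) P : ℝ) : ℂ)
          = ∑ k, ((keyDist n D k).toReal : ℂ) *
            V.weighted (encKey k) (G.output (encKey k)) fun x x' =>
              (if G.uBits x = G.uBits x' then 1 else 0) *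
                (ZMod.stdAddChar (t ⬝ᵥ (Y x' - Y x)) * charSum (P k) (Y x' - Y x)) := by
        intro P
        simp_rw [hY, ← sum_acceptProb_simulate, sampleAcceptProb, Complex.ofReal_sum,
          Complex.ofReal_mul, Finset.mul_sum]
        rw [Finset.sum_comm]
        refine Finset.sum_congr rfl fun k _ => Finset.sum_congr rfl fun c _ =>
          Finset.sum_congr rfl fun b _ => ?_
        ring
      simp_rw [Complex.ofReal_sub, mul_sub, Finset.sum_sub_distrib, hP]
      rw [← Finset.sum_sub_distrib, hδ]
      refine Finset.sum_congr rfl fun k _ => ?_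
      rw [← mul_sub, ← V.weighted_sub]
      by_cases hk : keyDist n D k = 0
      · simp [hk]
      congr 1
      refine V.weighted_congr _ fun x x' hx hx' => ?_
      have hz : G.uBits x = G.uBits x' → (k.2)ᵀ *ᵥ (Y x' - Y x) = 0 := by
        intro hu
        rw [(hsupp k hk x hx).1, (hsupp k hk x' hx').1] at hu
        rw [mulVec_sub, encVec_injective hu, sub_self]
      by_cases hu : G.uBits x = G.uBits x'
      · rw [hJ, h₁ k _ (hz hu), h₂, Minter.offDiagonal]
        simp only [hu, if_true]
        split_ifs <;> ring
      · simp [hJ, Minter.offDiagonal, hu]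
    rw [key]
    refine (norm_sum_le _ _).trans ?_
    calc _ ≤ ∑ c : VecLabel n q → Bool, ((2 : ℝ) ^ Fintype.card (VecLabel n q))⁻¹ * B := by
          refine Finset.sum_le_sum fun c _ => ?_
          rw [norm_mul, norm_inv, norm_pow, Complex.norm_ofNat, Complex.norm_real,
            Real.norm_eq_abs]
          exact mul_le_mul_of_nonneg_left (hB t c) (by positivity)
      _ = B := by
          rw [Finset.sum_const, Finset.card_univ, Fintype.card_fun, Fintype.card_bool,
            nsmul_eq_mul, ← mul_assoc]
          push_cast
          rw [mul_inv_cancel₀ (by positivity), one_mul]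
  obtain ⟨ν, hν, hνg⟩ := exists_approx_inverse (noiseDist m q σ hσ) K
  -- the part of the advantage that the approximate inverse does not see
  set ρ : ℂ := ∑ k, ((keyDist n D k).toReal : ℂ) *
    V.weighted (encKey k) (G.output (encKey k)) fun x x' =>
      J k.1 x x' * (1 - g (Y x' - Y x)) ^ K with hρ
  have hε : 0 ≤ 2 * (4 * Real.pi * (W * σ / q)) := by
    have := Real.pi_pos
    positivity
  have hρB : ‖ρ‖ ≤ 2 * (2 * (4 * Real.pi * (W * σ / q))) ^ K := by
    have hk : ∀ k, ‖((keyDist n D k).toReal : ℂ) *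
        V.weighted (encKey k) (G.output (encKey k)) fun x x' =>
          J k.1 x x' * (1 - g (Y x' - Y x)) ^ K‖
        ≤ (keyDist n D k).toReal * (2 * (2 * (4 * Real.pi * (W * σ / q))) ^ K) := by
      intro k
      rw [norm_mul, Complex.norm_real, Real.norm_of_nonneg ENNReal.toReal_nonneg]
      by_cases hk : keyDist n D k = 0
      · simp [hk]
      refine mul_le_mul_of_nonneg_left ?_ ENNReal.toReal_nonneg
      -- off the support of the state, `y` may be replaced by the short vector `0`
      set Y' : (G.Label → Bool) → Fin m → ZMod q :=
        fun x => if euclLength (Y x) ≤ W then Y x else 0 with hY'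
      have hcongr : V.weighted (encKey k) (G.output (encKey k)) (fun x x' =>
          J k.1 x x' * (1 - g (Y x' - Y x)) ^ K)
          = V.weighted (encKey k) (G.output (encKey k)) fun x x' =>
          J k.1 x x' * (1 - g (Y' x' - Y' x)) ^ K := by
        refine V.weighted_congr _ fun x x' hx hx' => ?_
        simp only [hY', (hsupp k hk x hx).2, (hsupp k hk x' hx').2, if_true]
      rw [hcongr]
      have hJb : SchurBounded (J k.1) 2 := G.schurBounded_offDiagonal f k.1
      have hshort : ∀ x, euclLength (Y' x) ≤ W := by
        intro x
        simp only [hY']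
        split_ifs with h
        · exact h
        · simpa [euclLength] using hW
      have hb := hJb.mul zero_le_two
        ((schurBounded_one_sub_charSum hσ Y' hshort hW).pow hε K)
      rw [mul_comm] at hb
      exact V.norm_weighted_le _ hb (G.sum_norm_sq_output _)
    refine (norm_sum_le _ _).trans ((Finset.sum_le_sum fun k _ => hk k).trans ?_)
    rw [← Finset.sum_mul, sum_pmf_toReal, one_mul]
  have hmain : ((acceptUnmeasured G V D - acceptMeasured G V D f : ℝ) : ℂ)
      = ∑ t, (ν t : ℂ) * δ t + ρ := by
    rw [acceptUnmeasured_sub_acceptMeasured]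
    rw [Finset.sum_congr rfl fun k _ => congrArg _ (V.weighted_eq_sum_add (encKey k)
      (G.output (encKey k)) (J k.1) Y (noiseDist m q σ hσ) K ν hνg)]
    simp_rw [mul_add, Finset.sum_add_distrib, hδ, Finset.mul_sum]
    rw [Finset.sum_comm]
    congr 1
    refine Finset.sum_congr rfl fun t _ => Finset.sum_congr rfl fun k _ => ?_
    ring
  have hB0 : 0 ≤ B := (norm_nonneg _).trans (hδB 0)
  calc |acceptUnmeasured G V D - acceptMeasured G V D f|
      = ‖∑ t, (ν t : ℂ) * δ t + ρ‖ := by rw [← hmain, Complex.norm_real, Real.norm_eq_abs]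
    _ ≤ ∑ t, |ν t| * B + ‖ρ‖ := by
        refine (norm_add_le _ _).trans (add_le_add ((norm_sum_le _ _).trans
          (Finset.sum_le_sum fun t _ => ?_)) le_rfl)
        rw [norm_mul, Complex.norm_real, Real.norm_eq_abs]
        exact mul_le_mul_of_nonneg_left (hδB t) (abs_nonneg _)
    _ ≤ _ := by
        rw [← Finset.sum_mul]
        refine add_le_add (mul_le_mul_of_nonneg_right ?_ hB0) hρB
        linarith

end Quantitative

/-! ### Asymptotics -/

section Asymptotic

theorem PolyBounded.add {f g : ℕ → ℕ} (hf : PolyBounded f) (hg : PolyBounded g) :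
    PolyBounded fun l => f l + g l := by
  obtain ⟨p, hp⟩ := hf
  obtain ⟨r, hr⟩ := hg
  exact ⟨p + r, fun l => by simpa using add_le_add (hp l) (hr l)⟩

theorem PolyBounded.mul {f g : ℕ → ℕ} (hf : PolyBounded f) (hg : PolyBounded g) :
    PolyBounded fun l => f l * g l := by
  obtain ⟨p, hp⟩ := hf
  obtain ⟨r, hr⟩ := hg
  exact ⟨p * r, fun l => by simpa using Nat.mul_le_mul (hp l) (hr l)⟩

/-- If `ε` tends to zero then `ε ^ (log l)` is negligible. -/
theorem negligible_pow_size {ε : ℕ → ℝ} (h0 : ∀ l, 0 ≤ ε l) (hε : Tendsto ε atTop (nhds 0)) :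
    Negligible fun l => ε l ^ Nat.size l := by
  intro c
  refine squeeze_zero' (Eventually.of_forall fun l => mul_nonneg (by positivity)
    (pow_nonneg (h0 l) _)) ?_ tendsto_inv_atTop_nhds_zero_nat
  filter_upwards [hε.eventually_le_const (show (0 : ℝ) < (2 ^ (c + 1))⁻¹ by positivity),
    eventually_gt_atTop 0] with l hl hl0
  have hl0' : (0 : ℝ) < l := by exact_mod_cast hl0
  have hlt : (l : ℝ) ≤ 2 ^ Nat.size l := by exact_mod_cast (Nat.lt_size_self l).le
  calc (l : ℝ) ^ c * ε l ^ Nat.size l ≤ (l : ℝ) ^ c * ((2 ^ (c + 1))⁻¹) ^ Nat.size l :=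
        mul_le_mul_of_nonneg_left (pow_le_pow_left₀ (h0 l) hl _) (by positivity)
    _ = (l : ℝ) ^ c * ((2 ^ Nat.size l) ^ (c + 1))⁻¹ := by rw [inv_pow, pow_right_comm]
    _ ≤ (l : ℝ) ^ c * ((l : ℝ) ^ (c + 1))⁻¹ := by gcongr
    _ = (l : ℝ)⁻¹ := by
        rw [pow_succ]
        field_simp

/-- The choice `K ≈ log l` makes both terms of the quantitative bound negligible. -/
theorem negligible_of_le_two_pow {f B ε : ℕ → ℝ} (hB : Negligible B) (h0 : ∀ l, 0 ≤ ε l)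
    (hε : Tendsto ε atTop (nhds 0)) (h : ∀ l K, |f l| ≤ 2 ^ K * |B l| + 2 * ε l ^ K) :
    Negligible f := by
  have h1 : Negligible fun l : ℕ => 2 * ((l : ℝ) * |B l|) :=
    (Asymptotics.SuperpolynomialDecay.trans_abs_le hB
      fun l => (abs_abs (B l)).le).param_mul.const_mul 2
  have h2 : Negligible fun l : ℕ => 2 * ε l ^ Nat.size l :=
    (negligible_pow_size h0 hε).const_mul 2
  refine (h1.add h2).trans_eventually_abs_le ?_
  filter_upwards [eventually_gt_atTop 0] with l hl
  refine (h l (Nat.size l)).trans (le_trans ?_ (le_abs_self _))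
  refine add_le_add ?_ le_rfl
  have hsize : (2 : ℝ) ^ Nat.size l ≤ 2 * l := by
    obtain ⟨k, hk⟩ := Nat.exists_eq_succ_of_ne_zero (Nat.size_pos.2 hl).ne'
    have hk' : 2 ^ k ≤ l := Nat.lt_size.1 (by omega)
    rw [hk, pow_succ']
    have : ((2 : ℝ) ^ k) ≤ l := by exact_mod_cast hk'
    linarith
  calc (2 : ℝ) ^ Nat.size l * |B l| ≤ 2 * l * |B l| := by gcongr
    _ = _ := by ring

theorem tendsto_ratio_zero {q : ℕ → ℕ} {W σ : ℕ → ℝ}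
    (h : (fun l : ℕ => √(Real.log l)) =o[atTop] fun l => q l / (W l * σ l)) :
    Tendsto (fun l => W l * σ l / q l) atTop (nhds 0) := by
  have h1 : (fun _ : ℕ => (1 : ℝ)) =O[atTop] fun l : ℕ => √(Real.log l) := by
    refine Asymptotics.IsBigO.of_bound 1 ?_
    filter_upwards [eventually_ge_atTop 3] with l hl
    have h3 : (3 : ℝ) ≤ l := by exact_mod_cast hl
    have h4 : 1 ≤ Real.log l := by
      rw [Real.le_log_iff_exp_le (by linarith)]
      exact Real.exp_one_lt_three.le.trans h3
    rw [norm_one, one_mul, Real.norm_of_nonneg (Real.sqrt_nonneg _)]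
    exact Real.one_le_sqrt.2 h4
  have h2 := tendsto_inv_atTop_zero.comp
    ((Asymptotics.isLittleO_one_left_iff ℝ).1 (h1.trans_isLittleO h))
  rw [tendsto_zero_iff_norm_tendsto_zero]
  refine h2.congr fun l => ?_
  rw [Function.comp_apply, ← norm_inv, inv_div]

end Asymptotic

section Main

variable (n m ℓ q : ℕ → ℕ) [∀ l, NeZero (q l)]

/-- If the samples from `P₁` and `P₂` cannot be distinguished, then the measurement of `f S y` cannot
be noticed. The shift and the signs of the reduction are chosen, for each security parameter, so
that its advantage is as large as possible. -/
theorem negligible_acceptUnmeasured_sub_acceptMeasured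
    (hn : PolyBounded n) (hm : PolyBounded m) (hℓ : PolyBounded ℓ)
    (hq : PolyBounded fun l => Nat.size (q l)) {W σ : ℕ → ℝ} (hW : ∀ l, 0 < W l)
    (hσ : ∀ l, 0 < σ l)
    (hgrowth : (fun l : ℕ => √(Real.log l)) =o[atTop] fun l => q l / (W l * σ l))
    (D : ∀ l, PMF (Matrix (Fin (m l)) (Fin (ℓ l)) (ZMod (q l))))
    {α : ℕ → Type} [∀ l, Fintype (α l)] [∀ l, DecidableEq (α l)]
    (f : ∀ l, Matrix (Fin (m l)) (Fin (ℓ l)) (ZMod (q l)) → (Fin (m l) → ZMod (q l)) → α l)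
    (P₁ P₂ : ∀ l, Matrix (Fin (m l)) (Fin (ℓ l)) (ZMod (q l)) ×
      Matrix (Fin (m l)) (Fin (n l)) (ZMod (q l)) → PMF (Fin (m l) → ZMod (q l)))
    (h₁ : ∀ l k z, (k.2)ᵀ *ᵥ z = 0 →
      charSum (P₁ l k) z = charSum (noiseDist (m l) (q l) (σ l) (hσ l)) z)
    (h₂ : ∀ l k y y', charSum (P₂ l k) (y' - y) = if f l k.1 y = f l k.1 y' then
      charSum (noiseDist (m l) (q l) (σ l) (hσ l)) (y' - y) else 0)
    (hard : ∀ E : ∀ l, Decider (KeyLabel (n l) (m l) (ℓ l) (q l) ⊕ VecLabel (m l) (q l)),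
      PolyBounded (fun l => (E l).size) → Negligible fun l =>
        sampleAcceptProb (E l) (keyDist (n l) (D l)) (P₁ l) -
        sampleAcceptProb (E l) (keyDist (n l) (D l)) (P₂ l))
    (G : ∀ l, Minter (n l) (m l) (ℓ l) (q l)) (hG : PolyBounded fun l => (G l).size)
    (hadm : ∀ l, (G l).Admissible (W l) (D l))
    (V : ∀ l, Decider (KeyLabel (n l) (m l) (ℓ l) (q l) ⊕ (G l).Label))
    (hV : PolyBounded fun l => (V l).size) :
    Negligible fun l => acceptUnmeasured (G l) (V l) (D l) -
      acceptMeasured (G l) (V l) (D l) (f l) := by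
  let adv : ∀ l, (Fin (m l) → ZMod (q l)) × (VecLabel (n l) (q l) → Bool) → ℝ := fun l b =>
    sampleAcceptProb (simulate (G l) (V l) (advice b.1 b.2)) (keyDist (n l) (D l)) (P₁ l) -
      sampleAcceptProb (simulate (G l) (V l) (advice b.1 b.2)) (keyDist (n l) (D l)) (P₂ l)
  have hmax : ∀ l, ∃ a, ∀ b, |adv l b| ≤ |adv l a| := fun l => Finite.exists_max _
  choose a ha using hmax
  have hE := hard (fun l => simulate (G l) (V l) (advice (a l).1 (a l).2)) (by
    simp_rw [size_simulate]
    have hmℓ := (hm.mul hℓ).mul hq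
    have hmn := (hm.mul hn).mul hq
    have hnq := hn.mul hq
    have hmq := hm.mul hq
    exact (((((hmℓ.add hmn).add hG).add (hmq.mul hq)).add (hnq.add hmq)).add hV).add
      ((hmℓ.add hmn).add (hnq.add hmq)))
  have hpi := Real.pi_pos
  refine negligible_of_le_two_pow hE
    (ε := fun l => 2 * (4 * Real.pi * (W l * σ l / q l))) (fun l => ?_) ?_ fun l K => ?_
  · have h1 := hW l
    have h2 := hσ l
    positivity
  · simpa using ((tendsto_ratio_zero hgrowth).const_mul (4 * Real.pi)).const_mul 2
  · exact abs_acceptUnmeasured_sub_acceptMeasured_le (G l) (V l) (hW l).le (hσ l) (D l) (hadm l)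
      (f l) (P₁ l) (P₂ l) (h₁ l) (h₂ l) _ (fun t c => ha l (t, c)) K

end Main

end LatticeCollapse

end

open LatticeCollapse
theorem mainTheorem1
    (n m q : ℕ → ℕ) [∀ l, NeZero (q l)] (W : ℕ → ℝ)
    (hn : PolyBounded n) (hm : PolyBounded m) (hq : PolyBounded fun l => Nat.size (q l))
    (hW : ∀ l, 0 < W l) :
    (∀ (ℓ : ℕ → ℕ), PolyBounded ℓ →
      ∀ (D : ∀ l, PMF (Matrix (Fin (m l)) (Fin (ℓ l)) (ZMod (q l))))
        (C : ∀ l, Matrix (Fin (m l)) (Fin (ℓ l)) (ZMod (q l)) →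
          Matrix (Fin (m l)) (Fin (m l - ℓ l)) (ZMod (q l))),
        (∀ l, ∀ S ∈ (D l).support, ∀ v : Fin (m l) → ZMod (q l),
          v ∈ Submodule.span (ZMod (q l)) (Set.range (C l S).col) ↔ Sᵀ *ᵥ v = 0) →
        (∃ (σ : ℕ → ℝ) (hσ : ∀ l, 0 < σ l),
          (fun l : ℕ => √(Real.log l)) =o[Filter.atTop] (fun l => q l / (W l * σ l)) ∧
          LWEHard n m ℓ q σ hσ D C) →
        MeasurementIndistinguishable n m ℓ q W D C) ∧
    ((∃ (σ : ℕ → ℝ) (hσ : ∀ l, 0 < σ l),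
        (fun l : ℕ => √(Real.log l)) =o[Filter.atTop] (fun l => q l / (W l * σ l)) ∧
        PlainLWEHard n m q σ hσ) →
      SISCollapsing n m q W) := by
  refine ⟨fun ℓ hℓ D C _ ⟨σ, hσ, hgrowth, hard⟩ G hG hadm V hV => ?_,
    fun ⟨σ, hσ, hgrowth, hard⟩ G hG hadm V hV => ?_⟩
  · refine negligible_acceptUnmeasured_sub_acceptMeasured n m ℓ q hn hm hℓ hq hW hσ hgrowth D
      (fun l S y => (C l S)ᵀ *ᵥ y) (fun l k => noisyImage (σ l) (hσ l) k.2)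
      (fun l k => noisyImage (σ l) (hσ l) (C l k.1)) (fun l k z hz => ?_) (fun l k y y' => ?_)
      hard G hG hadm V hV
    · rw [charSum_noisyImage, if_pos hz]
    · rw [charSum_noisyImage, mulVec_sub]
      simp only [sub_eq_zero, eq_comm]
  · refine negligible_acceptUnmeasured_sub_acceptMeasured n m (fun _ => 0) q hn hm ⟨0, by simp⟩ hq
      hW hσ hgrowth (fun l => PMF.pure 0) (fun l S y => y)
      (fun l k => noisyImage (σ l) (hσ l) k.2)
      (fun l _ => PMF.uniformOfFintype (Fin (m l) → ZMod (q l))) (fun l k z hz => ?_)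
      (fun l k y y' => ?_) hard G hG hadm V hV
    · rw [charSum_noisyImage, if_pos hz]
    · rw [charSum_uniform]
      by_cases h : y = y'
      · simp [h, charSum_zero]
      · rw [if_neg h, if_neg fun h' => h (sub_eq_zero.1 h').symm]
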